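/- Let $\mathcal{G}_6=\mathbb{R}^3/\Gamma_6$ be the Hantzsche–Wendt manifold, where $\Gamma_6$ is the group of isometries of Euclidean space $\mathbb{R}^3$ generated by $$(x,y,z)\mapsto(x+1,-y,-z+1),\quad (x,y,z)\mapsto(-x+1,y+1,-z),\quad (x,y,z)\mapsto(-x,-y+1,z+1),$$ and let $\mathcal{G}_2=\mathbb{R}^3/\Gamma_2$ be the half-turn manifold, where $\Gamma_2$ is generated by $$(x,y,z)\mapsto(x+1,y,z),\quad (x,y,z)\mapsto(x,y+1,z),\quad (x,y,z)\mapsto(-x,-y,z+1).$$ For a positive integer $m$ put $$\sigma_0(m)=\sum_{ab=m}1,\quad \sigma_1(m)=\sum_{ab=m}a,\quad d_3(m)=\sum_{ab=m}\sigma_0(a)=\sum_{abc=m}1,\quad \omega(m)=\sum_{ab=m}a\,\sigma_1(a)=\sum_{abc=m}a^2b,$$ where the sums are over ordered factorizations of $m$ into positive integers, and put $d_3(q)=\omega(q)=0$ for rational $q>0$ that is not an integer. Theorem 1. Every subgroup of finite index in $\pi_1(\mathcal{G}_6)$ is isomorphic to $\pi_1(\mathcal{G}_6)$, to $\pi_1(\mathcal{G}_2)$,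 or to $\mathbb{Z}^3$. For every integer $n\ge 1$ the number of subgroups of index $n$ in $\pi_1(\mathcal{G}_6)$ of each isomorphism type is finite, and (i) the number of those isomorphic to $\mathbb{Z}^3$ is $\omega\left(\frac n4\right)$; (ii) the number of those isomorphic to $\pi_1(\mathcal{G}_2)$ is $3\,\omega\left(\frac n2\right)-3\,\omega\left(\frac n4\right)$; (iii) the number of those isomorphic to $\pi_1(\mathcal{G}_6)$ is $n\left(d_3(n)-3d_3\left(\frac n2\right)+3d_3\left(\frac n4\right)-d_3\left(\frac n8\right)\right)$. -/

import Mathlib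

noncomputable section

namespace FlatThree

/-! ### Euclidean 3-space, its isometries, and quotients by groups of isometries -/

/-- Euclidean space of dimension three. -/
abbrev E3 : Type := EuclideanSpace ℝ (Fin 3)

/-- The tautological action of the isometry group on Euclidean space: `g • p = g p`. -/
instance isometryAction : MulAction (E3 ≃ᵢ E3) E3 where
  smul g p := g p
  one_smul _ := rfl
  mul_smul _ _ _ := rfl

/-- The quotient space (with the quotient topology) of Euclidean 3-space by a group of isometries,
that is, the space of orbits. -/
abbrev FlatQuotient (Γ : Subgroup (E3 ≃ᵢ E3)) : Type :=
  Quotient (MulAction.orbitRel Γ E3)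

/-- A map `E3 → E3` that is given in each coordinate by an isometry of the line is an isometry. -/
theorem isometry_of_coord (f : E3 → E3)
    (hf : ∀ p q i, dist (f p i) (f q i) = dist (p i) (q i)) : Isometry f := by
  refine Isometry.of_dist_eq fun p q => ?_
  simp only [EuclideanSpace.dist_eq, hf]

/-- `(x, y, z) ↦ (x + 1, -y, -z + 1)`. -/
def S₁ : E3 ≃ᵢ E3 :=
  IsometryEquiv.mk' (fun p => !₂[p 0 + 1, -p 1, -p 2 + 1])
    (fun p => !₂[p 0 - 1, -p 1, -p 2 + 1])
    (fun p => by ext i; fin_cases i <;> simp)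
    (isometry_of_coord _ fun p q i => by fin_cases i <;> simp)

/-- `(x, y, z) ↦ (-x + 1, y + 1, -z)`. -/
def S₂ : E3 ≃ᵢ E3 :=
  IsometryEquiv.mk' (fun p => !₂[-p 0 + 1, p 1 + 1, -p 2])
    (fun p => !₂[-p 0 + 1, p 1 - 1, -p 2])
    (fun p => by ext i; fin_cases i <;> simp)
    (isometry_of_coord _ fun p q i => by fin_cases i <;> simp)

/-- `(x, y, z) ↦ (-x, -y + 1, z + 1)`. -/
def S₃ : E3 ≃ᵢ E3 :=
  IsometryEquiv.mk' (fun p => !₂[-p 0, -p 1 + 1, p 2 + 1])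
    (fun p => !₂[-p 0, -p 1 + 1, p 2 - 1])
    (fun p => by ext i; fin_cases i <;> simp)
    (isometry_of_coord _ fun p q i => by fin_cases i <;> simp)

/-- The translation `(x, y, z) ↦ (x + 1, y, z)`. -/
def T₁ : E3 ≃ᵢ E3 :=
  IsometryEquiv.mk' (fun p => !₂[p 0 + 1, p 1, p 2])
    (fun p => !₂[p 0 - 1, p 1, p 2])
    (fun p => by ext i; fin_cases i <;> simp)
    (isometry_of_coord _ fun p q i => by fin_cases i <;> simp)

/-- The translation `(x, y, z) ↦ (x, y + 1, z)`. -/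
def T₂ : E3 ≃ᵢ E3 :=
  IsometryEquiv.mk' (fun p => !₂[p 0, p 1 + 1, p 2])
    (fun p => !₂[p 0, p 1 - 1, p 2])
    (fun p => by ext i; fin_cases i <;> simp)
    (isometry_of_coord _ fun p q i => by fin_cases i <;> simp)

/-- The screw motion `(x, y, z) ↦ (-x, -y, z + 1)` through a half turn. -/
def R : E3 ≃ᵢ E3 :=
  IsometryEquiv.mk' (fun p => !₂[-p 0, -p 1, p 2 + 1])
    (fun p => !₂[-p 0, -p 1, p 2 - 1])
    (fun p => by ext i; fin_cases i <;> simp)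
    (isometry_of_coord _ fun p q i => by fin_cases i <;> simp)

/-- The Bieberbach group of the Hantzsche–Wendt manifold. -/
def bieberbachG6 : Subgroup (E3 ≃ᵢ E3) := Subgroup.closure {S₁, S₂, S₃}

/-- The Bieberbach group of the half-turn manifold. The generators `x = T₁`, `y = T₂`, `z = R`
satisfy `x y = y x`, `z x z⁻¹ = x⁻¹`, `z y z⁻¹ = y⁻¹`. -/
def bieberbachG2 : Subgroup (E3 ≃ᵢ E3) := Subgroup.closure {T₁, T₂, R}

/-- The Hantzsche–Wendt manifold. -/
abbrev G6 : Type := FlatQuotient bieberbachG6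

/-- The half-turn manifold (dicosm): the orientable flat closed 3-manifold with holonomy of
order two. -/
abbrev G2 : Type := FlatQuotient bieberbachG2

/-- The free abelian group of rank three, written multiplicatively. -/
abbrev Z3 : Type := Multiplicative (Fin 3 → ℤ)

/-! ### Number-theoretic functions of a rational argument, zero off the positive integers -/

/-- `∑_{ab = q} f a b` over ordered pairs of positive integers with product `q`; the sum vanishes
if `q` is not a positive integer. -/
def factorSum (f : ℕ → ℕ → ℕ) (q : ℚ) : ℕ :=
  if q.den = 1 then ∑ ab ∈ q.num.toNat.divisorsAntidiagonal, f ab.1 ab.2 else 0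

/-- `σ₀(q) = ∑_{ab = q} 1`. -/
def sigma0 (q : ℚ) : ℕ := factorSum (fun _ _ => 1) q

/-- `σ₁(q) = ∑_{ab = q} a`. -/
def sigma1 (q : ℚ) : ℕ := factorSum (fun a _ => a) q

/-- `d₃(q) = ∑_{ab = q} σ₀(a)`. -/
def d3 (q : ℚ) : ℕ := factorSum (fun a _ => sigma0 a) q

/-- `ω(q) = ∑_{ab = q} a σ₁(a)`. -/
def omega (q : ℚ) : ℕ := factorSum (fun a _ => a * sigma1 a) q

/-! ### Subgroups of given index and isomorphism type -/

/-- The set of subgroups of index `n` in `G` that are isomorphic to `H`. -/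
def subgroupsOfType (H G : Type*) [Group H] [Group G] (n : ℕ) : Set (Subgroup G) :=
  {Δ | Δ.index = n ∧ Nonempty (Δ ≃* H)}

end FlatThree

end

/-! The deck group of the Hantzsche–Wendt manifold acts on each coordinate of ℝ³ by x ↦ ±x + t with
t an integer. It consists of the elements whose signs have product 1 and whose translation part in
coordinate i has parity given by the sign in coordinate i + 2. An element is thus determined by its
integral translation vector, which has even coordinate sum. Its pure translations form the lattice
(2ℤ)³ of index 4.

A subgroup of finite index is sorted by its signs (`holonomy_trichotomy`). It consists of
translations, or fixes the direction of exactly one axis without consisting of translations, or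
fixes no axis. These cases yield ℤ³, π₁(G₂) and π₁(G₆). The three groups are told apart by
commutativity and by homomorphisms to ℤ, so counting isomorphism types amounts to counting holonomy
types.

The first two counts use extensions of ℤ by a group N all of whose subgroups are normal in the
extension. A subgroup is given by its trace K on N, its image cℤ and a coset in N/K that fixes a
lift of c, so each pair (K, c) contributes |N/K| subgroups (`card_subgroups_index_map`). For ℤ² and
ℤ³ this produces σ₁ and ω. For the index 2 subgroup preserving an axis, N is the rank 2 lattice
orthogonal to it, and non-translation subgroups are those with c odd. This gives ω(n/2) − ω(n/4) for
each of the three axes.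

A subgroup fixing no axis is the stabilizer of a unique point of ∏ ℤ/cᵢ with all cᵢ odd and ∏ cᵢ = n
(`FullHolonomy.exists_eq_stabilizer`). Equivalently, it is the conjugate of the whole group by an
affine map x ↦ cx + t. There are n points for each factorization of n into three odd factors, and
the combination of values of d₃ counts these factorizations. -/

noncomputable section

namespace FlatThree

open Multiplicative (ofAdd)

/-! ### Integral coordinatewise isometries of ℝ³ -/

/-- The group of isometries `x ↦ sgn * x + trn` of the line that preserve the integers. -/
@[ext] structure InfDihedral where
  sgn : ℤˣ
  trn : ℤ

namespace InfDihedral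

instance : Mul InfDihedral := ⟨fun g h => ⟨g.sgn * h.sgn, g.trn + g.sgn * h.trn⟩⟩
instance : One InfDihedral := ⟨⟨1, 0⟩⟩
instance : Inv InfDihedral := ⟨fun g => ⟨g.sgn, -(g.sgn * g.trn)⟩⟩

@[simp] theorem mul_sgn (g h : InfDihedral) : (g * h).sgn = g.sgn * h.sgn := rfl
@[simp] theorem mul_trn (g h : InfDihedral) : (g * h).trn = g.trn + g.sgn * h.trn := rfl
@[simp] theorem one_sgn : (1 : InfDihedral).sgn = 1 := rfl
@[simp] theorem one_trn : (1 : InfDihedral).trn = 0 := rfl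
@[simp] theorem inv_sgn (g : InfDihedral) : g⁻¹.sgn = g.sgn := rfl
@[simp] theorem inv_trn (g : InfDihedral) : g⁻¹.trn = -(g.sgn * g.trn) := rfl

instance : Group InfDihedral :=
  Group.ofLeftAxioms
    (fun a b c => by ext <;> simp [mul_assoc, mul_add, add_assoc])
    (fun a => by ext <;> simp)
    (fun a => by ext <;> simp)

end InfDihedral

/-- The group of those isometries of `ℝ³` that act on each coordinate by an element of
`InfDihedral`. -/
abbrev CoordIsometries : Type := Fin 3 → InfDihedral

theorem unit_sq_real (e : ℤˣ) : (((e : ℤ) : ℝ)) * ((e : ℤ) : ℝ) = 1 := by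
  rcases Int.units_eq_one_or e with h | h <;> simp [h]

theorem dist_unit_mul_add (e : ℤˣ) (v : ℤ) (x y : ℝ) :
    dist (((e : ℤ) : ℝ) * x + v) (((e : ℤ) : ℝ) * y + v) = dist x y := by
  rcases Int.units_eq_one_or e with h | h <;> simp [h]

/-- The action of `CoordIsometries` on `ℝ³`. -/
def toIsometry : CoordIsometries →* (E3 ≃ᵢ E3) where
  toFun g := IsometryEquiv.mk'
    (fun p => WithLp.toLp 2 fun i => (((g i).sgn : ℤ) : ℝ) * p i + (g i).trn)
    (fun p => WithLp.toLp 2 fun i => (((g i).sgn : ℤ) : ℝ) * (p i - (g i).trn))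
    (fun p => by
      ext i
      simp [← mul_assoc, unit_sq_real])
    (isometry_of_coord _ fun p q i => dist_unit_mul_add _ _ _ _)
  map_one' := by
    ext p i
    simp [IsometryEquiv.mk']
  map_mul' g h := by
    ext p i
    simp [IsometryEquiv.mk']
    ring

@[simp] theorem toIsometry_apply (g : CoordIsometries) (p : E3) (i : Fin 3) :
    toIsometry g p i = (((g i).sgn : ℤ) : ℝ) * p i + (g i).trn := rfl

theorem toIsometry_injective : Function.Injective toIsometry := by
  intro g h hgh
  have key (p : E3) (i : Fin 3) : (((g i).sgn : ℤ) : ℝ) * p i + (g i).trn =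
      (((h i).sgn : ℤ) : ℝ) * p i + (h i).trn := by
    rw [← toIsometry_apply, hgh, toIsometry_apply]
  funext i
  -- The image of the origin gives the translation part, and the image of (1, 1, 1) then gives the
  -- sign.
  have h0 : (g i).trn = (h i).trn := by simpa using key 0 i
  have h1 := key (WithLp.toLp 2 fun _ => 1) i
  rw [h0] at h1
  ext
  · simpa using h1
  · exact h0

/-! ### Fundamental groups of quotients by free isometric actions -/

section Covering

open Topology

variable (Γ : Subgroup (E3 ≃ᵢ E3))

theorem isQuotientCoveringMap_of_dist (hΓ : ∀ g ∈ Γ, g ≠ 1 → ∀ p : E3, 1 ≤ dist (g p) p) :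
    IsQuotientCoveringMap (Quotient.mk (MulAction.orbitRel Γ E3)) Γ where
  __ := isQuotientMap_quotient_mk'
  continuous_const_smul g := g.1.continuous
  apply_eq_iff_mem_orbit := Quotient.eq''
  disjoint e := by
    -- Two points of a ball of radius 1/2 are less than 1 apart, so no nontrivial element can carry
    -- one to the other.
    refine ⟨Metric.ball e (1 / 2), Metric.ball_mem_nhds _ (by norm_num), ?_⟩
    rintro g ⟨_, ⟨a, ha, rfl⟩, hga⟩
    by_contra hg
    have h1 := hΓ g.1 g.2 (fun h => hg (Subtype.ext h)) a
    have h2 : dist (g.1 a) e < 1 / 2 := hga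
    have h3 : dist a e < 1 / 2 := ha
    have := dist_triangle_right (g.1 a) a e
    linarith

theorem nonempty_fundamentalGroup_mulEquiv
    (hΓ : ∀ g ∈ Γ, g ≠ 1 → ∀ p : E3, 1 ≤ dist (g p) p) (x : FlatQuotient Γ) :
    Nonempty (FundamentalGroup (FlatQuotient Γ) x ≃* Γ) := by
  have hcov := isQuotientCoveringMap_of_dist Γ hΓ
  obtain ⟨e, he⟩ := hcov.surjective x
  have : SimplyConnectedSpace E3 := inferInstance
  -- The covering identifies the fundamental group with the opposite of `Γ`, and inversion turns the
  -- opposite group back into `Γ`.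
  exact ⟨(hcov.fundamentalGroupEquiv ⟨e, he⟩).trans (MulEquiv.inv' Γ).symm⟩

end Covering

theorem one_le_dist_toIsometry {g : CoordIsometries} {i : Fin 3} (h1 : (g i).sgn = 1)
    (h2 : (g i).trn ≠ 0) (p : E3) : 1 ≤ dist (toIsometry g p) p := by
  have h : 1 ≤ dist (toIsometry g p i) (p i) := by
    rw [toIsometry_apply, h1, Real.dist_eq]
    simp only [Units.val_one, Int.cast_one, one_mul, add_sub_cancel_left]
    exact_mod_cast Int.one_le_abs h2
  refine h.trans ?_
  rw [EuclideanSpace.dist_eq]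
  refine Real.le_sqrt_of_sq_le ?_
  exact Finset.single_le_sum (f := fun i => dist (toIsometry g p i) (p i) ^ 2)
    (fun _ _ => sq_nonneg _) (Finset.mem_univ i)

/-- The fundamental group of the quotient of `ℝ³` by a group of coordinatewise isometries
each of which translates some coordinate. -/
theorem nonempty_fundamentalGroup_mulEquiv_of_translates (H : Subgroup CoordIsometries)
    (hH : ∀ g ∈ H, g ≠ 1 → ∃ i, (g i).sgn = 1 ∧ (g i).trn ≠ 0) {Γ : Subgroup (E3 ≃ᵢ E3)}
    (hΓ : H.map toIsometry = Γ) (x : FlatQuotient Γ) :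
    Nonempty (FundamentalGroup (FlatQuotient Γ) x ≃* H) := by
  subst hΓ
  obtain ⟨e⟩ := nonempty_fundamentalGroup_mulEquiv (H.map toIsometry) (by
    rintro _ ⟨g, hg, rfl⟩ hne p
    obtain ⟨i, h1, h2⟩ := hH g hg (by rintro rfl; simp at hne)
    exact one_le_dist_toIsometry h1 h2 p) x
  exact ⟨e.trans (H.equivMapOfInjective _ toIsometry_injective).symm⟩

/-! ### The two Bieberbach groups described by signs and parities -/

/-- The translations in `CoordIsometries`. -/
def translation : Multiplicative (Fin 3 → ℤ) →* CoordIsometries where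
  toFun v i := ⟨1, v.toAdd i⟩
  map_one' := rfl
  map_mul' v w := by ext <;> simp

@[simp] theorem translation_sgn (v : Multiplicative (Fin 3 → ℤ)) (i : Fin 3) :
    (translation v i).sgn = 1 := rfl

@[simp] theorem translation_trn (v : Multiplicative (Fin 3 → ℤ)) (i : Fin 3) :
    (translation v i).trn = v.toAdd i := rfl

theorem negOnePow_unit_mul (e : ℤˣ) (v : ℤ) : ((e : ℤ) * v).negOnePow = v.negOnePow := by
  rcases Int.units_eq_one_or e with h | h <;> simp [h]

/-- The Hantzsche–Wendt group inside `CoordIsometries`. -/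
def hantzscheWendt : Subgroup CoordIsometries where
  carrier := {g | (g 0).sgn * (g 1).sgn * (g 2).sgn = 1 ∧
    ∀ i, (g i).trn.negOnePow = (g (i + 2)).sgn}
  one_mem' := by simp
  mul_mem' := by
    rintro a b ⟨ha, ha'⟩ ⟨hb, hb'⟩
    refine ⟨?_, fun i => ?_⟩
    · calc _ = ((a 0).sgn * (a 1).sgn * (a 2).sgn) * ((b 0).sgn * (b 1).sgn * (b 2).sgn) := by
            simp only [Pi.mul_apply, InfDihedral.mul_sgn]
            ac_rfl
        _ = 1 := by rw [ha, hb, one_mul]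
    · simp [Int.negOnePow_add, negOnePow_unit_mul, ha', hb']
  inv_mem' := by
    rintro a ⟨ha, ha'⟩
    refine ⟨by simpa using ha, fun i => ?_⟩
    simp [negOnePow_unit_mul, ha']

/-- The half-turn group inside `CoordIsometries`. -/
def halfTurn : Subgroup CoordIsometries where
  carrier := {g | (g 0).sgn = (g 1).sgn ∧ (g 2).sgn = 1 ∧ (g 2).trn.negOnePow = (g 0).sgn}
  one_mem' := by simp
  mul_mem' := by
    rintro a b ⟨h0, h1, h2⟩ ⟨h0', h1', h2'⟩
    simp [Int.negOnePow_add, h0, h0', h1, h1', h2, h2']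
  inv_mem' := by
    rintro a ⟨h0, h1, h2⟩
    simp [h0, h1, h2]

theorem mem_hantzscheWendt {g : CoordIsometries} : g ∈ hantzscheWendt ↔
    (g 0).sgn * (g 1).sgn * (g 2).sgn = 1 ∧ ∀ i, (g i).trn.negOnePow = (g (i + 2)).sgn := Iff.rfl

theorem mem_halfTurn {g : CoordIsometries} : g ∈ halfTurn ↔
    (g 0).sgn = (g 1).sgn ∧ (g 2).sgn = 1 ∧ (g 2).trn.negOnePow = (g 0).sgn := Iff.rfl

/-- The first screw motion generating the Hantzsche–Wendt group. -/
def screw₁ : CoordIsometries := ![⟨1, 1⟩, ⟨-1, 0⟩, ⟨-1, 1⟩]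
/-- The second screw motion generating the Hantzsche–Wendt group. -/
def screw₂ : CoordIsometries := ![⟨-1, 1⟩, ⟨1, 1⟩, ⟨-1, 0⟩]
/-- The third screw motion generating the Hantzsche–Wendt group. -/
def screw₃ : CoordIsometries := ![⟨-1, 0⟩, ⟨-1, 1⟩, ⟨1, 1⟩]
/-- The screw motion `(x, y, z) ↦ (-x, -y, z + 1)`. -/
def screwR : CoordIsometries := ![⟨-1, 0⟩, ⟨-1, 0⟩, ⟨1, 1⟩]

theorem toIsometry_screw₁ : toIsometry screw₁ = S₁ := by
  ext p i; fin_cases i <;> simp [screw₁, S₁, IsometryEquiv.mk']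

theorem toIsometry_screw₂ : toIsometry screw₂ = S₂ := by
  ext p i; fin_cases i <;> simp [screw₂, S₂, IsometryEquiv.mk']

theorem toIsometry_screw₃ : toIsometry screw₃ = S₃ := by
  ext p i; fin_cases i <;> simp [screw₃, S₃, IsometryEquiv.mk']

theorem toIsometry_screwR : toIsometry screwR = R := by
  ext p i; fin_cases i <;> simp [screwR, R, IsometryEquiv.mk']

theorem toIsometry_translation_zero :
    toIsometry (translation (.ofAdd ![1, 0, 0])) = T₁ := by
  ext p i; fin_cases i <;> simp [T₁, IsometryEquiv.mk']

theorem toIsometry_translation_one :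
    toIsometry (translation (.ofAdd ![0, 1, 0])) = T₂ := by
  ext p i; fin_cases i <;> simp [T₂, IsometryEquiv.mk']

theorem translation_smul_mem {C : Subgroup CoordIsometries} {v : Fin 3 → ℤ}
    (h : translation (.ofAdd v) ∈ C) (n : ℤ) : translation (.ofAdd (n • v)) ∈ C := by
  rw [ofAdd_zsmul, map_zpow]
  exact C.zpow_mem h n

theorem translation_mem_of_axes {C : Subgroup CoordIsometries} {a b c : ℤ}
    (ha : translation (.ofAdd ![a, 0, 0]) ∈ C) (hb : translation (.ofAdd ![0, b, 0]) ∈ C)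
    (hc : translation (.ofAdd ![0, 0, c]) ∈ C) {v : Fin 3 → ℤ}
    (h0 : a ∣ v 0) (h1 : b ∣ v 1) (h2 : c ∣ v 2) : translation (.ofAdd v) ∈ C := by
  obtain ⟨x, hx⟩ := h0
  obtain ⟨y, hy⟩ := h1
  obtain ⟨z, hz⟩ := h2
  have h : translation (.ofAdd v) = translation (.ofAdd (x • ![a, 0, 0])) *
      translation (.ofAdd (y • ![0, b, 0])) * translation (.ofAdd (z • ![0, 0, c])) := by
    rw [← map_mul, ← map_mul, ← ofAdd_add, ← ofAdd_add]
    congr 2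
    funext i
    fin_cases i <;> simp [hx, hy, hz, mul_comm]
  rw [h]
  exact C.mul_mem (C.mul_mem (translation_smul_mem ha x) (translation_smul_mem hb y))
    (translation_smul_mem hc z)

theorem unit_triple {a b c : ℤˣ} (h : a * b * c = 1) :
    (a = 1 ∧ b = 1 ∧ c = 1) ∨ (a = 1 ∧ b = -1 ∧ c = -1) ∨ (a = -1 ∧ b = 1 ∧ c = -1) ∨
      (a = -1 ∧ b = -1 ∧ c = 1) := by
  rcases Int.units_eq_one_or a with rfl | rfl <;> rcases Int.units_eq_one_or b with rfl | rfl <;>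
    simp_all [neg_eq_iff_eq_neg]

/-- Squares of the screws are the translations by 2 along the axes. Signs determine the parities of
the translation part, so every element differs from 1 or from a screw by an even translation. -/
theorem hantzscheWendt_eq_closure :
    hantzscheWendt = Subgroup.closure {screw₁, screw₂, screw₃} := by
  apply le_antisymm
  · set C := Subgroup.closure {screw₁, screw₂, screw₃} with hC
    have m1 : screw₁ ∈ C := Subgroup.subset_closure (by simp)
    have m2 : screw₂ ∈ C := Subgroup.subset_closure (by simp)
    have m3 : screw₃ ∈ C := Subgroup.subset_closure (by simp)
    have t1 : translation (.ofAdd ![2, 0, 0]) ∈ C := by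
      convert C.mul_mem m1 m1 using 1
      funext i; fin_cases i <;> ext <;> simp [screw₁]
    have t2 : translation (.ofAdd ![0, 2, 0]) ∈ C := by
      convert C.mul_mem m2 m2 using 1
      funext i; fin_cases i <;> ext <;> simp [screw₂]
    have t3 : translation (.ofAdd ![0, 0, 2]) ∈ C := by
      convert C.mul_mem m3 m3 using 1
      funext i; fin_cases i <;> ext <;> simp [screw₃]
    have key (g s : CoordIsometries) (hs : s ∈ C) (h : ∀ i, (g i).sgn = (s i).sgn)
        (h' : ∀ i, 2 ∣ (g i).trn - (s i).trn) : g ∈ C := by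
      have : g = translation (.ofAdd fun i => (g i).trn - (s i).trn) * s := by
        funext i
        ext <;> simp [h]
      rw [this]
      exact C.mul_mem (translation_mem_of_axes t1 t2 t3 (h' 0) (h' 1) (h' 2)) hs
    rintro g ⟨hg, hg'⟩
    have g0 := hg' 0
    have g1 := hg' 1
    have g2 := hg' 2
    simp only [zero_add, Fin.reduceAdd] at g0 g1 g2
    rcases unit_triple hg with ⟨e0, e1, e2⟩ | ⟨e0, e1, e2⟩ | ⟨e0, e1, e2⟩ | ⟨e0, e1, e2⟩ <;>
      simp only [e0, e1, e2, Int.negOnePow_eq_one_iff, Int.negOnePow_eq_neg_one_iff] at g0 g1 g2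
    · refine key g 1 C.one_mem (fun i => ?_) fun i => ?_ <;> fin_cases i <;>
        simp [*, ← even_iff_two_dvd]
    · refine key g screw₁ m1 (fun i => ?_) fun i => ?_ <;> fin_cases i <;>
        simp [*, ← even_iff_two_dvd, screw₁]
    · refine key g screw₂ m2 (fun i => ?_) fun i => ?_ <;> fin_cases i <;>
        simp [*, ← even_iff_two_dvd, screw₂]
    · refine key g screw₃ m3 (fun i => ?_) fun i => ?_ <;> fin_cases i <;>
        simp [*, ← even_iff_two_dvd, screw₃]
  · rw [Subgroup.closure_le]
    rintro _ (rfl | rfl | rfl) <;> refine ⟨by simp [screw₁, screw₂, screw₃], fun i => ?_⟩ <;>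
      fin_cases i <;> simp [screw₁, screw₂, screw₃]

theorem halfTurn_eq_closure : halfTurn = Subgroup.closure
    {translation (.ofAdd ![1, 0, 0]), translation (.ofAdd ![0, 1, 0]), screwR} := by
  apply le_antisymm
  · set C := Subgroup.closure
      {translation (.ofAdd ![1, 0, 0]), translation (.ofAdd ![0, 1, 0]), screwR} with hC
    have t1 : translation (.ofAdd ![1, 0, 0]) ∈ C := Subgroup.subset_closure (by simp)
    have t2 : translation (.ofAdd ![0, 1, 0]) ∈ C := Subgroup.subset_closure (by simp)
    have m3 : screwR ∈ C := Subgroup.subset_closure (by simp)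
    have t3 : translation (.ofAdd ![0, 0, 2]) ∈ C := by
      convert C.mul_mem m3 m3 using 1
      funext i; fin_cases i <;> ext <;> simp [screwR]
    have key (g s : CoordIsometries) (hs : s ∈ C) (h : ∀ i, (g i).sgn = (s i).sgn)
        (h' : 2 ∣ (g 2).trn - (s 2).trn) : g ∈ C := by
      have : g = translation (.ofAdd fun i => (g i).trn - (s i).trn) * s := by
        funext i
        ext <;> simp [h]
      rw [this]
      exact C.mul_mem (translation_mem_of_axes t1 t2 t3 (one_dvd _) (one_dvd _) h') hs
    rintro g ⟨h0, h1, h2⟩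
    rcases Int.units_eq_one_or (g 0).sgn with e | e <;>
      rw [e] at h0 h2 <;> symm at h0 <;>
      simp only [Int.negOnePow_eq_one_iff, Int.negOnePow_eq_neg_one_iff] at h2
    · refine key g 1 C.one_mem (fun i => ?_) ?_
      · fin_cases i <;> simp [*]
      · simp [*, ← even_iff_two_dvd]
    · refine key g screwR m3 (fun i => ?_) ?_
      · fin_cases i <;> simp [*, screwR]
      · simp [*, ← even_iff_two_dvd, screwR]
  · rw [Subgroup.closure_le]
    rintro _ (rfl | rfl | rfl) <;> simp [mem_halfTurn, screwR]

theorem map_toIsometry_hantzscheWendt : hantzscheWendt.map toIsometry = bieberbachG6 := by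
  rw [hantzscheWendt_eq_closure, MonoidHom.map_closure, bieberbachG6]
  simp [Set.image_insert_eq, toIsometry_screw₁, toIsometry_screw₂, toIsometry_screw₃]

theorem map_toIsometry_halfTurn : halfTurn.map toIsometry = bieberbachG2 := by
  rw [halfTurn_eq_closure, MonoidHom.map_closure, bieberbachG2]
  simp [Set.image_insert_eq, toIsometry_translation_zero, toIsometry_translation_one,
    toIsometry_screwR]

theorem ne_zero_of_negOnePow_eq_neg_one {v : ℤ} (h : v.negOnePow = -1) : v ≠ 0 := by
  rintro rfl
  simp at h

theorem nonempty_fundamentalGroup_G6_mulEquiv (p : G6) :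
    Nonempty (FundamentalGroup G6 p ≃* hantzscheWendt) := by
  refine nonempty_fundamentalGroup_mulEquiv_of_translates _ (fun g hg hne => ?_)
    map_toIsometry_hantzscheWendt p
  obtain ⟨hg, hg'⟩ := hg
  rcases unit_triple hg with ⟨e0, e1, e2⟩ | ⟨e0, e1, e2⟩ | ⟨e0, e1, e2⟩ | ⟨e0, e1, e2⟩
  · by_contra! hc
    refine hne (funext fun i => ?_)
    have hi : (g i).sgn = 1 := by fin_cases i <;> assumption
    exact InfDihedral.ext hi (hc i hi)
  · exact ⟨0, e0, ne_zero_of_negOnePow_eq_neg_one ((hg' 0).trans e2)⟩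
  · exact ⟨1, e1, ne_zero_of_negOnePow_eq_neg_one ((hg' 1).trans e0)⟩
  · exact ⟨2, e2, ne_zero_of_negOnePow_eq_neg_one ((hg' 2).trans e1)⟩

theorem nonempty_fundamentalGroup_G2_mulEquiv (q : G2) :
    Nonempty (FundamentalGroup G2 q ≃* halfTurn) := by
  refine nonempty_fundamentalGroup_mulEquiv_of_translates _ (fun g hg hne => ?_)
    map_toIsometry_halfTurn q
  obtain ⟨h0, h1, h2⟩ := hg
  rcases Int.units_eq_one_or (g 0).sgn with e | e
  · by_contra! hc
    refine hne (funext fun i => ?_)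
    have hi : (g i).sgn = 1 := by fin_cases i <;> first | assumption | exact h0 ▸ e
    exact InfDihedral.ext hi (hc i hi)
  · exact ⟨2, h1, ne_zero_of_negOnePow_eq_neg_one (h2.trans e)⟩

/-! ### Counting subgroups of an extension of ℤ -/

section IntExtension

/-- Since `K` is normal, the join is the product `K * H`, so each left coset of `H` in it has a
representative in `K`. -/
theorem relIndex_sup_eq {G : Type*} [Group G] (H K : Subgroup G) [K.Normal] :
    H.relIndex (H ⊔ K) = H.relIndex K := by
  refine (Nat.card_congr (Equiv.ofBijective
    (Subgroup.quotientSubgroupOfEmbeddingOfLE H (le_sup_right : K ≤ H ⊔ K)) ⟨?_, ?_⟩)).symm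
  · exact Function.Embedding.injective _
  · intro q
    induction q using QuotientGroup.induction_on with
    | H x =>
      obtain ⟨x, hx⟩ := x
      have hx' := hx
      rw [sup_comm, ← SetLike.mem_coe, Subgroup.normal_mul, Set.mem_mul] at hx'
      obtain ⟨k, hk, h, hh, rfl⟩ := hx'
      refine ⟨QuotientGroup.mk ⟨k, hk⟩, ?_⟩
      rw [Subgroup.quotientSubgroupOfEmbeddingOfLE_apply_mk, QuotientGroup.eq,
        Subgroup.mem_subgroupOf]
      simpa using hh

variable {G : Type*} [Group G] {π : G →* Multiplicative ℤ}

theorem index_eq_mul_of_surjective (hπ : Function.Surjective π) (Δ : Subgroup G) :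
    Δ.index = (Δ.subgroupOf π.ker).index * (Δ.map π).index := by
  rw [Subgroup.index_map, MonoidHom.range_eq_top.mpr hπ, Subgroup.index_top, mul_one,
    ← Subgroup.relIndex_mul_index (le_sup_left : Δ ≤ Δ ⊔ π.ker), relIndex_sup_eq]
  rfl

theorem index_zpowers_ofAdd (c : ℤ) : (Subgroup.zpowers (ofAdd c)).index = c.natAbs := by
  rw [← Int.index_zmultiples, ← AddSubgroup.index_toSubgroup]
  rfl

theorem eq_zpowers_index (H : Subgroup (Multiplicative ℤ)) :
    H = Subgroup.zpowers (ofAdd (H.index : ℤ)) := by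
  obtain ⟨g, hg⟩ := (Subgroup.isCyclic_iff_exists_zpowers_eq_top H).mp inferInstance
  obtain ⟨c, rfl⟩ : ∃ c : ℤ, ofAdd c = g := ⟨g.toAdd, rfl⟩
  subst hg
  rw [index_zpowers_ofAdd]
  rcases Int.natAbs_eq c with h | h
  · rw [← h]
  · generalize (c.natAbs : ℤ) = d at *
    subst h
    rw [ofAdd_neg, Subgroup.zpowers_inv]

theorem mem_zpowers_ofAdd {c : ℤ} {x : Multiplicative ℤ} :
    x ∈ Subgroup.zpowers (ofAdd c) ↔ c ∣ x.toAdd := by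
  rw [Subgroup.mem_zpowers_iff]
  constructor
  · rintro ⟨k, rfl⟩
    simp
  · rintro ⟨k, hk⟩
    exact ⟨k, by rw [← ofAdd_zsmul, smul_eq_mul, mul_comm, ← hk]; rfl⟩

/-- The subgroup generated by a normal subgroup `K` and an element `x`. -/
def adjoinElement (K : Subgroup G) [K.Normal] (x : G) : Subgroup G :=
  (Subgroup.zpowers (QuotientGroup.mk' K x)).comap (QuotientGroup.mk' K)

theorem mem_adjoinElement {K : Subgroup G} [K.Normal] {x h : G} :
    h ∈ adjoinElement K x ↔ ∃ j : ℤ, (x ^ j)⁻¹ * h ∈ K := by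
  rw [adjoinElement, Subgroup.mem_comap, Subgroup.mem_zpowers_iff]
  refine exists_congr fun j => ?_
  rw [← map_zpow, QuotientGroup.mk'_apply, QuotientGroup.mk'_apply, QuotientGroup.eq]

theorem adjoinElement_congr {K : Subgroup G} [K.Normal] {x y : G} (h : x⁻¹ * y ∈ K) :
    adjoinElement K x = adjoinElement K y := by
  rw [adjoinElement, adjoinElement, QuotientGroup.mk'_apply, QuotientGroup.mk'_apply,
    QuotientGroup.eq.mpr h]

theorem self_mem_adjoinElement (K : Subgroup G) [K.Normal] (x : G) : x ∈ adjoinElement K x :=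
  mem_adjoinElement.mpr ⟨1, by simp [K.one_mem]⟩

theorem le_adjoinElement (K : Subgroup G) [K.Normal] (x : G) : K ≤ adjoinElement K x :=
  fun h hh => mem_adjoinElement.mpr ⟨0, by simpa using hh⟩

theorem map_adjoinElement {K : Subgroup G} [K.Normal] (hK : K ≤ π.ker) (x : G) :
    (adjoinElement K x).map π = Subgroup.zpowers (π x) := by
  apply le_antisymm
  · rintro _ ⟨h, hh, rfl⟩
    obtain ⟨j, hj⟩ := mem_adjoinElement.mp hh
    have := MonoidHom.mem_ker.mp (hK hj)
    rw [map_mul, map_inv, map_zpow, inv_mul_eq_one] at this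
    exact ⟨j, this⟩
  · rw [Subgroup.zpowers_le]
    exact ⟨x, self_mem_adjoinElement K x, rfl⟩

/-- Because `c ≠ 0`, the only power of `x` in the kernel is the trivial one. -/
theorem adjoinElement_inf_ker {K : Subgroup G} [K.Normal] (hK : K ≤ π.ker) {x : G} {c : ℤ}
    (hc : c ≠ 0) (hx : π x = ofAdd c) : adjoinElement K x ⊓ π.ker = K := by
  apply le_antisymm
  · rintro h ⟨hh, hh'⟩
    obtain ⟨j, hj⟩ := mem_adjoinElement.mp hh
    have := MonoidHom.mem_ker.mp (hK hj)
    rw [map_mul, map_inv, map_zpow, MonoidHom.mem_ker.mp hh', mul_one, inv_eq_one, hx,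
      ← ofAdd_zsmul, ofAdd_eq_one, smul_eq_mul] at this
    obtain rfl : j = 0 := by simpa [hc] using this
    simpa using hj
  · exact le_inf (le_adjoinElement K x) hK

theorem eq_adjoinElement {K Δ : Subgroup G} [K.Normal] (hK : Δ ⊓ π.ker = K) {x : G}
    (hx : x ∈ Δ) (hΔ : Δ.map π = Subgroup.zpowers (π x)) : Δ = adjoinElement K x := by
  apply le_antisymm
  · intro h hh
    have : π h ∈ Subgroup.zpowers (π x) := hΔ ▸ ⟨h, hh, rfl⟩
    obtain ⟨j, hj⟩ := this
    refine mem_adjoinElement.mpr ⟨j, hK ▸ Subgroup.mem_inf.mpr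
      ⟨Δ.mul_mem (Δ.inv_mem (Δ.zpow_mem hx j)) hh, ?_⟩⟩
    rw [MonoidHom.mem_ker, map_mul, map_inv, map_zpow, inv_mul_eq_one]
    exact hj
  · intro h hh
    obtain ⟨j, hj⟩ := mem_adjoinElement.mp hh
    have h1 : (x ^ j)⁻¹ * h ∈ Δ := by
      rw [← hK] at hj
      exact hj.1
    simpa using Δ.mul_mem (Δ.zpow_mem hx j) h1

/-- The subgroups of an extension of `ℤ` by `π.ker` with prescribed image and kernel correspond
to the cosets of the kernel. -/
theorem nonempty_subgroups_equiv_quotient (hπ : Function.Surjective π)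
    (hnormal : ∀ K : Subgroup G, K ≤ π.ker → K.Normal) {c : ℤ} (hc : c ≠ 0)
    (K : Subgroup π.ker) :
    Nonempty ({Δ : Subgroup G // Δ.map π = Subgroup.zpowers (ofAdd c) ∧ Δ.subgroupOf π.ker = K} ≃
      π.ker ⧸ K) := by
  -- With this lift fixed, the other lifts of `c` are the `x * n` with `n` in the kernel, and the
  -- subgroup generated by `K` and `x * n` depends only on the coset of `n`.
  obtain ⟨x, hx⟩ := hπ (ofAdd c)
  set K' : Subgroup G := K.map π.ker.subtype with hK'
  have hK'le : K' ≤ π.ker := Subgroup.map_subtype_le K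
  have : K'.Normal := hnormal K' hK'le
  have hsub : ∀ Δ : Subgroup G, Δ.subgroupOf π.ker = K ↔ Δ ⊓ π.ker = K' := by
    intro Δ
    rw [hK', ← Subgroup.subgroupOf_map_subtype]
    exact (Subgroup.map_injective π.ker.subtype_injective).eq_iff.symm
  have hmemK : ∀ n : π.ker, n ∈ K ↔ (n : G) ∈ K' := by
    intro n
    rw [hK']
    exact (Subgroup.mem_map_iff_mem π.ker.subtype_injective).symm
  have hπn : ∀ n : π.ker, π (x * n) = ofAdd c := by
    intro n
    rw [map_mul, MonoidHom.mem_ker.mp n.2, mul_one, hx]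
  have hcongr : ∀ m n : π.ker, (x * m : G)⁻¹ * (x * n) = ((m⁻¹ * n : π.ker) : G) := by
    intro m n
    simp [mul_assoc]
  refine ⟨(Equiv.ofBijective (Quotient.lift
    (fun n : π.ker => (⟨adjoinElement K' (x * n), ?_, ?_⟩ : {Δ : Subgroup G //
      Δ.map π = Subgroup.zpowers (ofAdd c) ∧ Δ.subgroupOf π.ker = K})) ?_) ⟨?_, ?_⟩).symm⟩
  · rw [map_adjoinElement hK'le, hπn]
  · rw [hsub, adjoinElement_inf_ker hK'le hc (hπn n)]
  · intro m n hmn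
    refine Subtype.ext (adjoinElement_congr ?_)
    rw [hcongr, ← hmemK]
    exact QuotientGroup.leftRel_apply.mp hmn
  · intro a b
    induction a using QuotientGroup.induction_on with | H m =>
    induction b using QuotientGroup.induction_on with | H n =>
    intro h
    have h1 : adjoinElement K' (x * m) = adjoinElement K' (x * n) := congrArg Subtype.val h
    rw [QuotientGroup.eq, hmemK, ← hcongr, ← adjoinElement_inf_ker hK'le hc (hπn n)]
    refine Subgroup.mem_inf.mpr ⟨mul_mem (inv_mem ?_) (self_mem_adjoinElement _ _), ?_⟩
    · rw [← h1]
      exact self_mem_adjoinElement _ _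
    · rw [hcongr]
      exact (m⁻¹ * n).2
  · rintro ⟨Δ, h1, h2⟩
    have : ofAdd c ∈ Δ.map π := h1 ▸ Subgroup.mem_zpowers _
    obtain ⟨y, hy, hyc⟩ := this
    have hn : x⁻¹ * y ∈ π.ker := by
      rw [MonoidHom.mem_ker, map_mul, map_inv, hx, hyc, inv_mul_cancel]
    refine ⟨QuotientGroup.mk ⟨x⁻¹ * y, hn⟩, Subtype.ext ?_⟩
    change adjoinElement K' (x * (x⁻¹ * y)) = Δ
    rw [mul_inv_cancel_left]
    exact (eq_adjoinElement ((hsub Δ).mp h2) hy (by rw [h1, hyc])).symm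

/-- The number of subgroups of given index. -/
def numSubgroups (N : Type*) [Group N] (k : ℕ) : ℕ := Nat.card {K : Subgroup N // K.index = k}

/-- A group has finitely many subgroups of each finite index. -/
def FinitelyManySubgroups (N : Type*) [Group N] : Prop :=
  ∀ k : ℕ, k ≠ 0 → Finite {K : Subgroup N // K.index = k}

/-- The trace on the kernel is one of the subgroups `K` of index `k`, and over each such `K` there
is one `Δ` for each of the `k` cosets. -/
theorem card_subgroups_map_index (hπ : Function.Surjective π)
    (hnormal : ∀ K : Subgroup G, K ≤ π.ker → K.Normal) (hfin : FinitelyManySubgroups π.ker)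
    {c : ℤ} (hc : c ≠ 0) {k : ℕ} (hk : k ≠ 0) :
    Finite {Δ : Subgroup G // Δ.map π = Subgroup.zpowers (ofAdd c) ∧
      (Δ.subgroupOf π.ker).index = k} ∧
    Nat.card {Δ : Subgroup G // Δ.map π = Subgroup.zpowers (ofAdd c) ∧
      (Δ.subgroupOf π.ker).index = k} = k * numSubgroups π.ker k := by
  let e : {Δ : Subgroup G // Δ.map π = Subgroup.zpowers (ofAdd c) ∧
      (Δ.subgroupOf π.ker).index = k} ≃ Σ K : {K : Subgroup π.ker // K.index = k},
      {Δ : Subgroup G // Δ.map π = Subgroup.zpowers (ofAdd c) ∧ Δ.subgroupOf π.ker = K.1} :=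
    { toFun Δ := ⟨⟨Δ.1.subgroupOf π.ker, Δ.2.2⟩, Δ.1, Δ.2.1, rfl⟩
      invFun x := ⟨x.2.1, x.2.2.1, by rw [x.2.2.2, x.1.2]⟩
      left_inv _ := rfl
      right_inv := by
        rintro ⟨⟨K, hK⟩, Δ, h1, h2⟩
        have h : Δ.subgroupOf π.ker = K := h2
        subst h
        rfl }
  have := hfin k hk
  have := Fintype.ofFinite {K : Subgroup π.ker // K.index = k}
  have hcard : ∀ K : {K : Subgroup π.ker // K.index = k}, Nat.card {Δ : Subgroup G //
      Δ.map π = Subgroup.zpowers (ofAdd c) ∧ Δ.subgroupOf π.ker = K.1} = k := by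
    intro K
    obtain ⟨f⟩ := nonempty_subgroups_equiv_quotient hπ hnormal hc K.1
    rw [Nat.card_congr f]
    exact K.2
  have hfin' : ∀ K : {K : Subgroup π.ker // K.index = k}, Finite {Δ : Subgroup G //
      Δ.map π = Subgroup.zpowers (ofAdd c) ∧ Δ.subgroupOf π.ker = K.1} :=
    fun K => Nat.finite_of_card_ne_zero (by rw [hcard]; exact hk)
  refine ⟨Finite.of_equiv _ e.symm, ?_⟩
  rw [Nat.card_congr e, Nat.card_sigma, Finset.sum_congr rfl fun K _ => hcard K,
    Finset.sum_const, Finset.card_univ, smul_eq_mul, mul_comm, numSubgroups,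
    Nat.card_eq_fintype_card]

/-- Subgroups of index `m` in an extension of `ℤ` by `π.ker`, counted by the index of their
image in `ℤ`. -/
theorem card_subgroups_index_map (hπ : Function.Surjective π)
    (hnormal : ∀ K : Subgroup G, K ≤ π.ker → K.Normal) (hfin : FinitelyManySubgroups π.ker)
    (P : ℕ → Prop) [DecidablePred P] {m : ℕ} (hm : m ≠ 0) :
    Finite {Δ : Subgroup G // Δ.index = m ∧ P (Δ.map π).index} ∧
    Nat.card {Δ : Subgroup G // Δ.index = m ∧ P (Δ.map π).index} =
      ∑ x ∈ m.divisorsAntidiagonal with P x.2, x.1 * numSubgroups π.ker x.1 := by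
  let A := m.divisorsAntidiagonal.filter fun x => P x.2
  have hA : ∀ x ∈ A, x.1 * x.2 = m ∧ P x.2 := fun x hx => by simpa [A, hm] using hx
  let e : {Δ : Subgroup G // Δ.index = m ∧ P (Δ.map π).index} ≃ Σ x : A,
      {Δ : Subgroup G // Δ.map π = Subgroup.zpowers (ofAdd (x.1.2 : ℤ)) ∧
        (Δ.subgroupOf π.ker).index = x.1.1} :=
    { toFun Δ := ⟨⟨((Δ.1.subgroupOf π.ker).index, (Δ.1.map π).index), by
          simpa [A, hm, ← index_eq_mul_of_surjective hπ] using Δ.2⟩, Δ.1, eq_zpowers_index _, rfl⟩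
      invFun x := ⟨x.2.1, by
        have h := hA x.1 x.1.2
        rw [index_eq_mul_of_surjective hπ, x.2.2.1, x.2.2.2, index_zpowers_ofAdd,
          Int.natAbs_natCast]
        exact h⟩
      left_inv _ := rfl
      right_inv := by
        rintro ⟨⟨⟨k, c⟩, hkc⟩, Δ, h1, h2⟩
        obtain rfl : (Δ.map π).index = c := by
          rw [h1, index_zpowers_ofAdd, Int.natAbs_natCast]
        have h : (Δ.subgroupOf π.ker).index = k := h2
        subst h
        rfl }
  have hx : ∀ x : A, (x.1.2 : ℤ) ≠ 0 ∧ x.1.1 ≠ 0 := by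
    intro x
    have := (hA x.1 x.2).1
    constructor
    · intro h
      simp [Int.natCast_eq_zero.mp h] at this
      exact hm this.symm
    · intro h
      simp [h] at this
      exact hm this.symm
  have key := fun x : A => card_subgroups_map_index hπ hnormal hfin (hx x).1 (hx x).2
  have := fun x : A => (key x).1
  refine ⟨Finite.of_equiv _ e.symm, ?_⟩
  rw [Nat.card_congr e, Nat.card_sigma, Finset.sum_congr rfl fun x _ => (key x).2,
    Finset.sum_coe_sort A fun x => x.1 * numSubgroups π.ker x.1]

end IntExtension

/-! ### Invariance of subgroup counts under isomorphism -/

section Transport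

variable {N N' : Type*} [Group N] [Group N']

/-- Isomorphic groups have the same subgroups of each index. -/
def subgroupsOfIndexEquiv (e : N ≃* N') (k : ℕ) :
    {K : Subgroup N // K.index = k} ≃ {K : Subgroup N' // K.index = k} :=
  e.mapSubgroup.toEquiv.subtypeEquiv fun K => by
    rw [← Subgroup.index_map_equiv K e]
    rfl

theorem numSubgroups_congr (e : N ≃* N') (k : ℕ) : numSubgroups N k = numSubgroups N' k :=
  Nat.card_congr (subgroupsOfIndexEquiv e k)

theorem FinitelyManySubgroups.congr (e : N ≃* N') (h : FinitelyManySubgroups N) :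
    FinitelyManySubgroups N' := fun k hk =>
  have := h k hk
  Finite.of_equiv _ (subgroupsOfIndexEquiv e k)

end Transport

/-! ### Subgroups of ℤⁿ for n ≤ 3 -/

section FreeAbelian

/-- The kernel of the projection of a product to its second factor. -/
def kerSndEquiv (A B : Type*) [Group A] [Group B] : (MonoidHom.snd A B).ker ≃* A where
  toFun n := n.1.1
  invFun a := ⟨(a, 1), rfl⟩
  left_inv := by
    rintro ⟨⟨a, b⟩, h⟩
    obtain rfl : b = 1 := h
    rfl
  right_inv _ := rfl
  map_mul' _ _ := rfl

/-- Normality is automatic in a commutative group, so the extension count applies. Iterating it from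
the trivial group produces 1, `sigma1` and `omega`. -/
theorem subgroups_prod_int (A : Type*) [CommGroup A] (hA : FinitelyManySubgroups A) :
    FinitelyManySubgroups (A × Multiplicative ℤ) ∧ ∀ m ≠ 0,
      numSubgroups (A × Multiplicative ℤ) m =
        ∑ x ∈ m.divisorsAntidiagonal, x.1 * numSubgroups A x.1 := by
  have key := fun (m : ℕ) (hm : m ≠ 0) => card_subgroups_index_map
    (π := MonoidHom.snd A (Multiplicative ℤ)) (fun b => ⟨(1, b), rfl⟩) (fun _ _ => inferInstance)
    (hA.congr (kerSndEquiv A _).symm) (fun _ => True) hm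
  simp only [and_true, Finset.filter_true, numSubgroups_congr (kerSndEquiv A _)] at key
  exact ⟨fun m hm => (key m hm).1, fun m hm => (key m hm).2⟩

/-- Splitting off the first coordinate of `ℤⁿ⁺¹`. -/
def consEquiv (n : ℕ) : Multiplicative (Fin n → ℤ) × Multiplicative ℤ ≃*
    Multiplicative (Fin (n + 1) → ℤ) where
  toFun x := ofAdd (Fin.cons x.2.toAdd x.1.toAdd)
  invFun v := (ofAdd (Fin.tail v.toAdd), ofAdd (v.toAdd 0))
  left_inv _ := rfl
  right_inv v := congrArg ofAdd (Fin.cons_self_tail v.toAdd)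
  map_mul' x y := by
    rw [← ofAdd_add]
    congr 1
    funext i
    refine Fin.cases ?_ (fun j => ?_) i <;> rfl

theorem subgroups_pi_int_succ (n : ℕ)
    (hn : FinitelyManySubgroups (Multiplicative (Fin n → ℤ))) :
    FinitelyManySubgroups (Multiplicative (Fin (n + 1) → ℤ)) ∧ ∀ m ≠ 0,
      numSubgroups (Multiplicative (Fin (n + 1) → ℤ)) m =
        ∑ x ∈ m.divisorsAntidiagonal, x.1 * numSubgroups (Multiplicative (Fin n → ℤ)) x.1 := by
  obtain ⟨h1, h2⟩ := subgroups_prod_int _ hn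
  exact ⟨h1.congr (consEquiv n), fun m hm => by rw [← h2 m hm, numSubgroups_congr (consEquiv n)]⟩

theorem subgroups_of_subsingleton (N : Type*) [Group N] [Subsingleton N] :
    FinitelyManySubgroups N ∧ ∀ k, numSubgroups N k = if k = 1 then 1 else 0 := by
  refine ⟨fun k _ => inferInstance, fun k => ?_⟩
  have hidx : ∀ K : Subgroup N, K.index = 1 := fun K => by
    rw [Subgroup.index_eq_one]
    exact Subsingleton.elim _ _
  split_ifs with h
  · subst h
    exact Nat.card_eq_one_iff_unique.mpr ⟨inferInstance, ⟨⊤, hidx _⟩⟩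
  · have : IsEmpty {K : Subgroup N // K.index = k} := ⟨fun K => h (K.2.symm.trans (hidx _))⟩
    exact Nat.card_of_isEmpty

theorem factorSum_natCast (f : ℕ → ℕ → ℕ) (m : ℕ) :
    factorSum f (m : ℚ) = ∑ x ∈ m.divisorsAntidiagonal, f x.1 x.2 := by
  simp [factorSum]

theorem subgroups_int_pow_one : FinitelyManySubgroups (Multiplicative (Fin 1 → ℤ)) ∧
    ∀ m ≠ 0, numSubgroups (Multiplicative (Fin 1 → ℤ)) m = 1 := by
  obtain ⟨h0, h0'⟩ := subgroups_of_subsingleton (Multiplicative (Fin 0 → ℤ))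
  obtain ⟨h1, h1'⟩ := subgroups_pi_int_succ 0 h0
  refine ⟨h1, fun m hm => ?_⟩
  rw [h1' m hm, Finset.sum_eq_single (1, m)]
  · simp [h0']
  · rintro ⟨a, b⟩ hab hne
    rw [Nat.mem_divisorsAntidiagonal] at hab
    have : a ≠ 1 := by
      rintro rfl
      simp at hab
      simp [hab.1] at hne
    simp [h0', this]
  · simp [hm]

theorem subgroups_int_pow_two : FinitelyManySubgroups (Multiplicative (Fin 2 → ℤ)) ∧
    ∀ m ≠ 0, numSubgroups (Multiplicative (Fin 2 → ℤ)) m = sigma1 m := by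
  obtain ⟨h1, h1'⟩ := subgroups_int_pow_one
  obtain ⟨h2, h2'⟩ := subgroups_pi_int_succ 1 h1
  refine ⟨h2, fun m hm => ?_⟩
  rw [h2' m hm, sigma1, factorSum_natCast]
  refine Finset.sum_congr rfl fun x hx => ?_
  rw [h1' _ (Nat.ne_zero_of_mem_divisorsAntidiagonal hx).1, mul_one]

theorem subgroups_int_pow_three : FinitelyManySubgroups Z3 ∧
    ∀ m ≠ 0, numSubgroups Z3 m = omega m := by
  obtain ⟨h2, h2'⟩ := subgroups_int_pow_two
  obtain ⟨h3, h3'⟩ := subgroups_pi_int_succ 2 h2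
  refine ⟨h3, fun m hm => ?_⟩
  rw [h3' m hm, omega, factorSum_natCast]
  refine Finset.sum_congr rfl fun x hx => ?_
  rw [h2' _ (Nat.ne_zero_of_mem_divisorsAntidiagonal hx).1]

/-- Subgroups of finite index in `ℤⁿ` are isomorphic to `ℤⁿ`. -/
theorem nonempty_mulEquiv_of_index_ne_zero {n : ℕ} (H : Subgroup (Multiplicative (Fin n → ℤ)))
    (hH : H.index ≠ 0) : Nonempty (H ≃* Multiplicative (Fin n → ℤ)) := by
  let A : AddSubgroup (Fin n → ℤ) := Subgroup.toAddSubgroup' H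
  have : A.FiniteIndex := ⟨hH⟩
  have h := A.finrank_eq_of_finiteIndex
  have : Module.Finite ℤ A := inferInstanceAs (Module.Finite ℤ (AddSubgroup.toIntSubmodule A))
  have : Module.Free ℤ A := inferInstanceAs (Module.Free ℤ (AddSubgroup.toIntSubmodule A))
  let e := LinearEquiv.ofFinrankEq A (Fin n → ℤ) h
  exact ⟨AddEquiv.toMultiplicative e.toAddEquiv⟩

end FreeAbelian

/-! ### Recognizing semidirect products in which ℤ acts by inversion -/

section Recognition

/-- The action of `ℤ` on a commutative group through inversion. -/
def inversionAction (A : Type*) [CommGroup A] : Multiplicative ℤ →* MulAut A :=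
  zpowersHom (MulAut A) (MulEquiv.inv A)

/-- This is the compatibility needed to map the semidirect product to `G`; induction on `j` runs in
both directions from 0. -/
theorem conj_zpow_eq_inversionAction {A G : Type*} [CommGroup A] [Group G] (f : A →* G) {x : G}
    (hx : ∀ a, x * f a * x⁻¹ = (f a)⁻¹) (j : ℤ) (a : A) :
    x ^ j * f a * (x ^ j)⁻¹ = f (inversionAction A (ofAdd j) a) := by
  have hx' : ∀ a, MulAut.conj x (f a) = f a⁻¹ := fun a => by rw [map_inv]; exact hx a
  have hx'' : ∀ a, (MulAut.conj x)⁻¹ (f a) = f a⁻¹ := fun a => by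
    rw [MulAut.inv_apply, MulEquiv.symm_apply_eq, hx', inv_inv]
  have h1 : ∀ j : ℤ, inversionAction A (ofAdd j) = (MulEquiv.inv A : MulAut A) ^ j := fun _ => rfl
  change MulAut.conj (x ^ j) (f a) = _
  rw [h1, map_zpow]
  induction j using Int.induction_on generalizing a with
  | zero => rfl
  | succ i ih => rw [zpow_add_one, zpow_add_one, MulAut.mul_apply, MulAut.mul_apply, hx', ih]; rfl
  | pred i ih => rw [zpow_sub_one, zpow_sub_one, MulAut.mul_apply, MulAut.mul_apply, hx'', ih]; rfl

/-- An extension of an infinite cyclic group by a commutative group, in which a lift of the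
generator acts by inversion, is determined by the kernel. -/
theorem nonempty_mulEquiv_semidirectProduct {A G : Type*} [CommGroup A] [Group G]
    (π : G →* Multiplicative ℤ) (e : π.ker ≃* A) {x : G} {c : ℤ} (hc : c ≠ 0)
    (hx : π x = ofAdd c) (hrange : ∀ g, c ∣ (π g).toAdd)
    (hinv : ∀ n ∈ π.ker, x * n * x⁻¹ = n⁻¹) :
    Nonempty (G ≃* A ⋊[inversionAction A] Multiplicative ℤ) := by
  let f : A →* G := π.ker.subtype.comp e.symm.toMonoidHom
  have hf : ∀ a, x * f a * x⁻¹ = (f a)⁻¹ := fun a => hinv _ (e.symm a).2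
  have hπf : ∀ a, π (f a) = 1 := fun a => (e.symm a).2
  have hfinj : Function.Injective f := Subtype.val_injective.comp e.symm.injective
  let F : A ⋊[inversionAction A] Multiplicative ℤ →* G :=
    SemidirectProduct.lift f (zpowersHom G x) (by
      intro z
      ext a
      exact (conj_zpow_eq_inversionAction f hf z.toAdd a).symm)
  have hF : ∀ y, F y = f y.left * x ^ y.right.toAdd := fun y => rfl
  have hπx : ∀ j : ℤ, π (x ^ j) = ofAdd (j * c) := fun j => by
    rw [map_zpow, hx, ← ofAdd_zsmul, smul_eq_mul]
  refine ⟨(MulEquiv.ofBijective F ⟨?_, ?_⟩).symm⟩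
  · rw [injective_iff_map_eq_one]
    intro y hy
    have h1 := congrArg π hy
    rw [hF, map_mul, hπf, one_mul, hπx, map_one, ofAdd_eq_one] at h1
    have h2 : y.right.toAdd = 0 := by simpa [hc] using h1
    rw [hF, h2, zpow_zero, mul_one] at hy
    have h3 : y.left = 1 := hfinj (by rw [hy, map_one])
    exact SemidirectProduct.ext h3 h2
  · intro g
    -- Here `j` is the exponent for which `g * (x ^ j)⁻¹` falls into the kernel.
    obtain ⟨j, hj⟩ := hrange g
    have hker : g * (x ^ j)⁻¹ ∈ π.ker := by
      rw [MonoidHom.mem_ker, map_mul, map_inv, hπx, mul_inv_eq_one, mul_comm, ← hj]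
      rfl
    refine ⟨⟨e ⟨_, hker⟩, ofAdd j⟩, ?_⟩
    rw [hF]
    change ((e.symm (e _) : π.ker) : G) * x ^ j = g
    rw [MulEquiv.symm_apply_apply, inv_mul_cancel_right]

end Recognition

/-! ### Signs, translation parts and the translation lattice -/

section Coordinates

/-- The sign with which an element acts on a coordinate. -/
def sgnHom (i : Fin 3) : hantzscheWendt →* ℤˣ where
  toFun g := (g.1 i).sgn
  map_one' := rfl
  map_mul' _ _ := rfl

/-- The translation part of an element in a coordinate. -/
def trnAt (i : Fin 3) (g : hantzscheWendt) : ℤ := (g.1 i).trn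

@[simp] theorem trnAt_one (i : Fin 3) : trnAt i 1 = 0 := rfl

@[simp] theorem trnAt_mul (i : Fin 3) (g h : hantzscheWendt) :
    trnAt i (g * h) = trnAt i g + sgnHom i g * trnAt i h := rfl

@[simp] theorem trnAt_inv (i : Fin 3) (g : hantzscheWendt) :
    trnAt i g⁻¹ = -(sgnHom i g * trnAt i g) := rfl

theorem sgnHom_mul_mul (i : Fin 3) (g : hantzscheWendt) :
    sgnHom i g * sgnHom (i + 1) g * sgnHom (i + 2) g = 1 := by
  have h : sgnHom 0 g * sgnHom 1 g * sgnHom 2 g = 1 := g.2.1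
  fin_cases i
  · exact h
  · rw [mul_assoc, mul_comm] at h
    exact h
  · rw [mul_comm, ← mul_assoc] at h
    exact h

theorem negOnePow_trnAt (i : Fin 3) (g : hantzscheWendt) :
    (trnAt i g).negOnePow = sgnHom (i + 2) g := g.2.2 i

/-- The sign in coordinate `i` is the parity of the translation part in coordinate `i + 1`, so the
image of the origin determines the element. -/
theorem hantzscheWendt_ext {g h : hantzscheWendt} (H : ∀ i, trnAt i g = trnAt i h) : g = h := by
  refine Subtype.ext (funext fun i => InfDihedral.ext ?_ (H i))
  have := negOnePow_trnAt (i + 1) g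
  rw [H, negOnePow_trnAt, add_assoc] at this
  simpa [sgnHom] using this.symm

/-- Signs are prescribed by the parities of the next coordinates; their product is the parity of the
coordinate sum. -/
theorem exists_trnAt_eq (v : Fin 3 → ℤ) (hv : Even (v 0 + v 1 + v 2)) :
    ∃ g : hantzscheWendt, ∀ i, trnAt i g = v i := by
  refine ⟨⟨fun i => ⟨(v (i + 1)).negOnePow, v i⟩, ?_, fun i => ?_⟩, fun i => rfl⟩
  · rw [← Int.negOnePow_add, ← Int.negOnePow_add, Int.negOnePow_eq_one_iff]
    convert hv using 1
    simp only [zero_add, Fin.reduceAdd]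
    ring
  · simp [add_assoc]

theorem sgnHom_add_two_of {i : Fin 3} {g : hantzscheWendt} (h : sgnHom i g = 1) :
    sgnHom (i + 2) g = sgnHom (i + 1) g := by
  have := sgnHom_mul_mul i g
  rw [h, one_mul, mul_eq_one_iff_eq_inv] at this
  rw [this, Int.units_inv_eq_self]

theorem forall_fin_three {p : Fin 3 → Prop} (i : Fin 3) (h0 : p i) (h1 : p (i + 1))
    (h2 : p (i + 2)) (j : Fin 3) : p j := by
  have : j = i ∨ j = i + 1 ∨ j = i + 2 := by omega
  rcases this with rfl | rfl | rfl <;> assumption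

theorem sgnHom_eq_one_iff_even {i : Fin 3} {g : hantzscheWendt} (h : sgnHom i g = 1) :
    sgnHom (i + 1) g = 1 ↔ Even (trnAt i g) := by
  rw [← sgnHom_add_two_of h, ← negOnePow_trnAt, Int.negOnePow_eq_one_iff]

/-- The lattice of translations in the Hantzsche–Wendt group. -/
def translations : Subgroup hantzscheWendt := ⨅ i, (sgnHom i).ker

theorem mem_translations {g : hantzscheWendt} : g ∈ translations ↔ ∀ i, sgnHom i g = 1 := by
  simp [translations, Subgroup.mem_iInf, MonoidHom.mem_ker]

theorem even_trnAt_of_mem_translations {g : hantzscheWendt} (h : g ∈ translations) (i : Fin 3) :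
    Even (trnAt i g) := by
  rw [← Int.negOnePow_eq_one_iff, negOnePow_trnAt]
  exact mem_translations.mp h _

/-- The inclusion of the translation lattice. -/
def evenTranslation : Z3 →* hantzscheWendt where
  -- In multiplicative notation `v ^ 2` is the doubled vector; pure translations of the group have
  -- even entries.
  toFun v := ⟨translation (v ^ 2), by
    simp [mem_hantzscheWendt, pow_two, Int.negOnePow_add, Int.units_mul_self]⟩
  map_one' := Subtype.ext (by simp)
  map_mul' v w := Subtype.ext
    ((congrArg translation (mul_pow v w 2)).trans (map_mul translation _ _))

@[simp] theorem sgnHom_evenTranslation (i : Fin 3) (v : Z3) :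
    sgnHom i (evenTranslation v) = 1 := rfl

@[simp] theorem trnAt_evenTranslation (i : Fin 3) (v : Z3) :
    trnAt i (evenTranslation v) = 2 * v.toAdd i := by
  simp [trnAt, evenTranslation, pow_two, two_mul]

theorem evenTranslation_mem (v : Z3) : evenTranslation v ∈ translations :=
  mem_translations.mpr fun _ => rfl

theorem evenTranslation_injective : Function.Injective evenTranslation := by
  intro v w h
  refine Multiplicative.toAdd.injective (funext fun i => ?_)
  have := congrArg (trnAt i) h
  simpa using this

theorem exists_evenTranslation_eq {g : hantzscheWendt} (h : g ∈ translations) :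
    ∃ v, evenTranslation v = g := by
  refine ⟨ofAdd fun i => trnAt i g / 2, hantzscheWendt_ext fun i => ?_⟩
  rw [trnAt_evenTranslation]
  exact Int.mul_ediv_cancel' (even_trnAt_of_mem_translations h i).two_dvd

theorem range_evenTranslation : evenTranslation.range = translations := by
  ext g
  exact ⟨fun ⟨v, hv⟩ => hv ▸ evenTranslation_mem v, exists_evenTranslation_eq⟩

/-- The translation lattice is free abelian of rank three. -/
def translationsEquiv : translations ≃* Z3 :=
  ((MonoidHom.ofInjective evenTranslation_injective).trans
    (MulEquiv.subgroupCongr range_evenTranslation)).symm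

theorem exists_sgnHom_eq (a b : ℤˣ) : ∃ g, sgnHom 0 g = a ∧ sgnHom 1 g = b := by
  have : ∃ v w : ℤ, v.negOnePow = a ∧ w.negOnePow = b := by
    rcases Int.units_eq_one_or a with rfl | rfl <;> rcases Int.units_eq_one_or b with rfl | rfl
    exacts [⟨0, 0, by simp⟩, ⟨0, 1, by simp⟩, ⟨1, 0, by simp⟩, ⟨1, 1, by simp⟩]
  obtain ⟨v, w, rfl, rfl⟩ := this
  -- The last two entries govern the signs in coordinates 0 and 1; the entry `v + w` makes the sum
  -- even.
  obtain ⟨g, hg⟩ := exists_trnAt_eq ![v + w, v, w] ⟨v + w, by simp; ring⟩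
  refine ⟨g, ?_, ?_⟩
  · rw [← show (trnAt 1 g).negOnePow = sgnHom 0 g from negOnePow_trnAt 1 g, hg]
    rfl
  · rw [← show (trnAt 2 g).negOnePow = sgnHom 1 g from negOnePow_trnAt 2 g, hg]
    rfl

theorem index_translations : translations.index = 4 := by
  let f : hantzscheWendt →* ℤˣ × ℤˣ := (sgnHom 0).prod (sgnHom 1)
  have hf : Function.Surjective f := fun ⟨a, b⟩ => by
    obtain ⟨g, h0, h1⟩ := exists_sgnHom_eq a b
    exact ⟨g, Prod.ext h0 h1⟩
  have hker : f.ker = translations := by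
    ext g
    rw [MonoidHom.mem_ker, mem_translations, MonoidHom.prod_apply, Prod.mk_eq_one]
    refine ⟨fun h => forall_fin_three 0 h.1 h.2 ?_, fun h => ⟨h 0, h 1⟩⟩
    exact (sgnHom_add_two_of h.1).trans h.2
  rw [← hker, Subgroup.index_ker, MonoidHom.range_eq_top.mpr hf, Subgroup.card_top, Nat.card_eq_fintype_card]
  rfl

theorem index_ker_sgnHom (i : Fin 3) : (sgnHom i).ker.index = 2 := by
  have hf : Function.Surjective (sgnHom i) := by
    intro a
    have h01 := exists_sgnHom_eq a a
    have h02 := exists_sgnHom_eq 1 a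
    fin_cases i
    · exact ⟨h01.choose, h01.choose_spec.1⟩
    · exact ⟨h01.choose, h01.choose_spec.2⟩
    · exact ⟨h02.choose, (sgnHom_add_two_of h02.choose_spec.1).trans h02.choose_spec.2⟩
  rw [Subgroup.index_ker, MonoidHom.range_eq_top.mpr hf, Subgroup.card_top, Nat.card_eq_fintype_card]
  rfl

end Coordinates

/-! ### Subgroups preserving the direction of an axis -/

section Axis

variable (i : Fin 3)

/-- The translation part along the axis that is preserved. -/
def trnHom : (sgnHom i).ker →* Multiplicative ℤ where
  toFun g := ofAdd (trnAt i g)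
  map_one' := rfl
  map_mul' g h := by
    rw [← ofAdd_add, Subgroup.coe_mul, trnAt_mul, MonoidHom.mem_ker.mp g.2, Units.val_one, one_mul]

theorem toAdd_trnHom (g : (sgnHom i).ker) : (trnHom i g).toAdd = trnAt i g := rfl

theorem trnHom_surjective : Function.Surjective (trnHom i) := by
  intro c
  -- The zero in position `i + 1` forces sign 1 on axis `i`; repeating the value in position `i + 2`
  -- makes the sum even.
  let v : Fin 3 → ℤ := fun j => if j = i + 1 then 0 else c.toAdd
  have h1 : v i = c.toAdd := if_neg (by omega)
  have h2 : v (i + 1) = 0 := if_pos rfl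
  obtain ⟨g, hg⟩ := exists_trnAt_eq v ⟨c.toAdd, by fin_cases i <;> simp [v]⟩
  have hs : sgnHom i g = 1 := by
    have := negOnePow_trnAt (i + 1) g
    rw [hg, h2, add_assoc, Int.negOnePow_zero] at this
    simpa using this.symm
  exact ⟨⟨g, hs⟩, Multiplicative.toAdd.injective ((hg i).trans h1)⟩

variable {i}

theorem mem_translations_of_trnAt_eq_zero {g : hantzscheWendt} (h : sgnHom i g = 1)
    (h' : trnAt i g = 0) : g ∈ translations := by
  have h1 : sgnHom (i + 1) g = 1 := (sgnHom_eq_one_iff_even h).mpr (by simp [h'])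
  exact mem_translations.mpr (forall_fin_three i h h1 ((sgnHom_add_two_of h).trans h1))

/-- The kernel consists of translations orthogonal to the axis, and the signs of `g` on the two
orthogonal coordinates agree. Hence every subgroup of the kernel is normal. -/
theorem trnHom_conj {g n : (sgnHom i).ker} (hn : n ∈ (trnHom i).ker) :
    (sgnHom (i + 1) g = 1 → g * n * g⁻¹ = n) ∧ (sgnHom (i + 1) g = -1 → g * n * g⁻¹ = n⁻¹) := by
  have hn0 : trnAt i n = 0 := congrArg Multiplicative.toAdd (MonoidHom.mem_ker.mp hn)
  have hn1 := mem_translations.mp (mem_translations_of_trnAt_eq_zero n.2 hn0)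
  have hg := MonoidHom.mem_ker.mp g.2
  have hg2 := sgnHom_add_two_of hg
  constructor <;> intro h <;> refine Subtype.ext (hantzscheWendt_ext ?_) <;>
    refine forall_fin_three i ?_ ?_ ?_ <;>
    simp [hn0, hn1, hg, hg2, h]

theorem normal_of_le_ker_trnHom (K : Subgroup (sgnHom i).ker) (hK : K ≤ (trnHom i).ker) :
    K.Normal := by
  refine ⟨fun n hn g => ?_⟩
  obtain ⟨h1, h2⟩ := trnHom_conj (g := g) (hK hn)
  rcases Int.units_eq_one_or (sgnHom (i + 1) g) with h | h
  · rwa [h1 h]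
  · rw [h2 h]
    exact K.inv_mem hn

variable (i)

/-- The translations orthogonal to an axis. -/
def orthogonalTranslation : Multiplicative (Fin 2 → ℤ) →* (sgnHom i).ker where
  toFun w := ⟨evenTranslation (ofAdd (i.insertNth 0 w.toAdd)), rfl⟩
  map_one' := Subtype.ext (hantzscheWendt_ext fun j => by
    refine Fin.succAboveCases i ?_ (fun k => ?_) j <;> simp)
  map_mul' v w := Subtype.ext (hantzscheWendt_ext fun j => by
    refine Fin.succAboveCases i ?_ (fun k => ?_) j <;> simp [mul_add])

theorem orthogonalTranslation_injective : Function.Injective (orthogonalTranslation i) := by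
  intro v w h
  have h1 := evenTranslation_injective (congrArg Subtype.val h)
  have h2 := congrArg (i.removeNth) (Multiplicative.ofAdd.injective h1)
  simpa using h2

theorem range_orthogonalTranslation : (orthogonalTranslation i).range = (trnHom i).ker := by
  ext g
  constructor
  · rintro ⟨w, rfl⟩
    refine MonoidHom.mem_ker.mpr (Multiplicative.toAdd.injective ?_)
    rw [toAdd_trnHom]
    simp [orthogonalTranslation]
  · intro hg
    have h0 : trnAt i g = 0 := congrArg Multiplicative.toAdd (MonoidHom.mem_ker.mp hg)
    obtain ⟨v, hv⟩ := exists_evenTranslation_eq (mem_translations_of_trnAt_eq_zero g.2 h0)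
    have h1 : v.toAdd i = 0 := by
      rw [← hv] at h0
      simpa using h0
    refine ⟨ofAdd (i.removeNth v.toAdd), Subtype.ext ?_⟩
    rw [← hv]
    refine congrArg evenTranslation (congrArg ofAdd ?_)
    rw [toAdd_ofAdd, ← h1, Fin.insertNth_self_removeNth]
    rfl

/-- The translations orthogonal to an axis form a free abelian group of rank two. -/
def kerTrnHomEquiv : (trnHom i).ker ≃* Multiplicative (Fin 2 → ℤ) :=
  ((MonoidHom.ofInjective (orthogonalTranslation_injective i)).trans
    (MulEquiv.subgroupCongr (range_orthogonalTranslation i))).symm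

/-- The semidirect product `ℤ² ⋊ ℤ`, where the generator of `ℤ` acts by inversion. -/
abbrev HalfTurnModel : Type :=
  Multiplicative (Fin 2 → ℤ) ⋊[inversionAction (Multiplicative (Fin 2 → ℤ))] Multiplicative ℤ

variable {i}

theorem exists_trnAt_eq_index (Δ : Subgroup (sgnHom i).ker) :
    (∃ x ∈ Δ, trnAt i x = (Δ.map (trnHom i)).index) ∧
      ∀ x ∈ Δ, ((Δ.map (trnHom i)).index : ℤ) ∣ trnAt i x := by
  have h := eq_zpowers_index (Δ.map (trnHom i))
  constructor
  · obtain ⟨x, hx, hx'⟩ : ofAdd ((Δ.map (trnHom i)).index : ℤ) ∈ Δ.map (trnHom i) :=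
      h.ge (Subgroup.mem_zpowers _)
    exact ⟨x, hx, congrArg Multiplicative.toAdd hx'⟩
  · intro x hx
    have hx' : trnHom i x ∈ Δ.map (trnHom i) := ⟨x, hx, rfl⟩
    rw [h, mem_zpowers_ofAdd] at hx'
    exact hx'

/-- The index generates the group of axial translation parts, and an element preserving the axis is
a pure translation exactly when its axial part is even. -/
theorem odd_index_map_trnHom_iff (Δ : Subgroup (sgnHom i).ker) :
    Odd (Δ.map (trnHom i)).index ↔ ¬ ∀ x ∈ Δ, (x : hantzscheWendt) ∈ translations := by
  obtain ⟨⟨x, hx, hxc⟩, hdvd⟩ := exists_trnAt_eq_index Δ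
  rw [← Nat.not_even_iff_odd, not_iff_not]
  constructor
  · intro he y hy
    have h1 : Even (trnAt i y) := by
      rw [even_iff_two_dvd] at he ⊢
      exact (Int.natCast_dvd_natCast.mpr he).trans (hdvd y hy)
    have h2 := (sgnHom_eq_one_iff_even y.2).mpr h1
    exact mem_translations.mpr (forall_fin_three i y.2 h2 ((sgnHom_add_two_of y.2).trans h2))
  · intro h
    have := even_trnAt_of_mem_translations (h x hx) i
    rw [hxc] at this
    exact_mod_cast this

/-- An element realizing the odd generator of the image is a half-turn screw, so it inverts the
kernel, which has finite index in a lattice of rank 2. -/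
theorem nonempty_mulEquiv_halfTurnModel (Δ : Subgroup (sgnHom i).ker) (hΔ : Δ.index ≠ 0)
    (hodd : Odd (Δ.map (trnHom i)).index) : Nonempty (Δ ≃* HalfTurnModel) := by
  obtain ⟨⟨x, hx, hxc⟩, hdvd⟩ := exists_trnAt_eq_index Δ
  have hidx : (Δ.subgroupOf (trnHom i).ker).index ≠ 0 := by
    rw [index_eq_mul_of_surjective (trnHom_surjective i)] at hΔ
    exact left_ne_zero_of_mul hΔ
  let e₁ : ((trnHom i).comp Δ.subtype).ker ≃* Δ.subgroupOf (trnHom i).ker :=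
    { toFun n := ⟨⟨n.1.1, n.2⟩, n.1.2⟩
      invFun n := ⟨⟨n.1.1, n.2⟩, n.1.2⟩
      left_inv _ := rfl
      right_inv _ := rfl
      map_mul' _ _ := rfl }
  let e₂ := (kerTrnHomEquiv i).subgroupMap (Δ.subgroupOf (trnHom i).ker)
  obtain ⟨e₃⟩ := nonempty_mulEquiv_of_index_ne_zero
    ((Δ.subgroupOf (trnHom i).ker).map (kerTrnHomEquiv i).toMonoidHom) (by
      rw [← Subgroup.index_map_equiv _ (kerTrnHomEquiv i)] at hidx
      exact hidx)
  refine nonempty_mulEquiv_semidirectProduct ((trnHom i).comp Δ.subtype)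
    ((e₁.trans e₂).trans e₃) (x := ⟨x, hx⟩) (c := (Δ.map (trnHom i)).index)
    (by exact_mod_cast hodd.pos.ne') (congrArg ofAdd hxc) (fun g => hdvd g.1 g.2) ?_
  intro n hn
  refine Subtype.ext ((trnHom_conj (g := x) (n := n.1) hn).2 ?_)
  rw [← sgnHom_add_two_of x.2, ← negOnePow_trnAt, hxc, Int.negOnePow_eq_neg_one_iff]
  exact_mod_cast hodd

end Axis

/-! ### Subgroups preserving no axis, as stabilizers of residue points -/

section FullHolonomy

/-- The points of `ℤ³` up to congruence modulo `c i` in the `i`-th coordinate. -/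
def ResiduePoints (c : Fin 3 → ℕ) : Type := ∀ i, ZMod (c i)

instance residueAction (c : Fin 3 → ℕ) : MulAction hantzscheWendt (ResiduePoints c) where
  smul g x i := ((sgnHom i g : ℤ) : ZMod (c i)) * x i + (trnAt i g : ZMod (c i))
  one_smul x := funext fun i => by
    change ((sgnHom i 1 : ℤ) : ZMod (c i)) * x i + (trnAt i 1 : ZMod (c i)) = x i
    simp
  mul_smul g h x := funext fun i => by
    change ((sgnHom i (g * h) : ℤ) : ZMod (c i)) * x i + (trnAt i (g * h) : ZMod (c i)) =
      ((sgnHom i g : ℤ) : ZMod (c i)) * (((sgnHom i h : ℤ) : ZMod (c i)) * x i +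
        (trnAt i h : ZMod (c i))) + (trnAt i g : ZMod (c i))
    rw [map_mul, trnAt_mul]
    push_cast
    ring

variable {c : Fin 3 → ℕ}

theorem smul_residue_apply (g : hantzscheWendt) (x : ResiduePoints c) (i : Fin 3) :
    (g • x) i = ((sgnHom i g : ℤ) : ZMod (c i)) * x i + (trnAt i g : ZMod (c i)) := rfl

theorem mem_stabilizer_residue {g : hantzscheWendt} {x : ResiduePoints c} :
    g ∈ MulAction.stabilizer hantzscheWendt x ↔
      ∀ i, ((sgnHom i g : ℤ) : ZMod (c i)) * x i + (trnAt i g : ZMod (c i)) = x i := by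
  rw [MulAction.mem_stabilizer_iff]
  exact funext_iff

theorem isUnit_two_zmod {n : ℕ} (hn : Odd n) : IsUnit (2 : ZMod n) := by
  have := (ZMod.isUnit_iff_coprime 2 n).mpr hn.coprime_two_left
  exact_mod_cast this

/-- Only even translations are available, but 2 is invertible modulo each odd `c i`. -/
theorem exists_translation_smul_eq (hc : ∀ i, Odd (c i)) (x y : ResiduePoints c) :
    ∃ τ ∈ translations, τ • x = y := by
  have h (i : Fin 3) : ∃ w : ℤ, ((2 * w : ℤ) : ZMod (c i)) = y i - x i := by
    obtain ⟨z, hz⟩ := (isUnit_two_zmod (hc i)).dvd (a := y i - x i)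
    obtain ⟨w, rfl⟩ := ZMod.intCast_surjective z
    exact ⟨w, by rw [hz]; push_cast; rfl⟩
  choose w hw using h
  refine ⟨evenTranslation (ofAdd w), evenTranslation_mem _, funext fun i => ?_⟩
  rw [smul_residue_apply, sgnHom_evenTranslation, trnAt_evenTranslation, toAdd_ofAdd, hw]
  simp

theorem index_stabilizer_residue (hc : ∀ i, Odd (c i)) (x : ResiduePoints c) :
    (MulAction.stabilizer hantzscheWendt x).index = ∏ i, c i := by
  have : MulAction.IsPretransitive hantzscheWendt (ResiduePoints c) :=
    ⟨fun x y => (exists_translation_smul_eq hc x y).imp fun _ h => h.2⟩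
  rw [MulAction.index_stabilizer_of_transitive]
  change Nat.card (∀ i, ZMod (c i)) = _
  simp [Nat.card_pi]

/-- Transitivity of the translations lets one correct `g` to fix `x` without changing its signs. -/
theorem exists_mem_stabilizer_sgnHom_eq (hc : ∀ i, Odd (c i)) (x : ResiduePoints c)
    (g : hantzscheWendt) :
    ∃ h ∈ MulAction.stabilizer hantzscheWendt x, ∀ i, sgnHom i h = sgnHom i g := by
  obtain ⟨τ, hτ, hx⟩ := exists_translation_smul_eq hc (g • x) x
  refine ⟨τ * g, ?_, fun i => ?_⟩
  · rwa [MulAction.mem_stabilizer_iff, mul_smul]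
  · rw [map_mul, mem_translations.mp hτ, one_mul]

theorem exists_sgnHom_eq_neg_one (i : Fin 3) : ∃ g, sgnHom i g = -1 := by
  by_contra! h
  have : (sgnHom i).ker = ⊤ := by
    rw [eq_top_iff]
    exact fun g _ => (Int.units_eq_one_or _).resolve_right (h g)
  have h2 := index_ker_sgnHom i
  rw [this, Subgroup.index_top] at h2
  omega

/-- The elements of a subgroup do not all fix the direction of one axis. -/
def FullHolonomy (Δ : Subgroup hantzscheWendt) : Prop := ∀ i, ¬ Δ ≤ (sgnHom i).ker

theorem FullHolonomy.exists_eq_neg_one {Δ : Subgroup hantzscheWendt} (hΔ : FullHolonomy Δ)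
    (i : Fin 3) : ∃ g ∈ Δ, sgnHom i g = -1 := by
  obtain ⟨g, hg, h⟩ := SetLike.not_le_iff_exists.mp (hΔ i)
  exact ⟨g, hg, (Int.units_eq_one_or _).resolve_left h⟩

theorem fullHolonomy_stabilizer (hc : ∀ i, Odd (c i)) (x : ResiduePoints c) :
    FullHolonomy (MulAction.stabilizer hantzscheWendt x) := by
  intro i hle
  obtain ⟨g, hg⟩ := exists_sgnHom_eq_neg_one i
  obtain ⟨h, hh, hs⟩ := exists_mem_stabilizer_sgnHom_eq hc x g
  have h1 : sgnHom i h = 1 := hle hh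
  rw [hs, hg] at h1
  exact absurd h1 (by decide)

/-- The element translates by 2k along one axis, and an odd modulus divides 2k only if it divides k.
This recovers the moduli from the stabilizer. -/
theorem axis_mem_stabilizer_iff (hc : ∀ i, Odd (c i)) (x : ResiduePoints c) (i : Fin 3) (k : ℤ) :
    evenTranslation (ofAdd (Pi.single i k)) ∈ MulAction.stabilizer hantzscheWendt x ↔
      (c i : ℤ) ∣ k := by
  rw [mem_stabilizer_residue]
  have h2 : (c i : ℤ) ∣ k ↔ (c i : ℤ) ∣ 2 * k := by
    refine ⟨fun h => h.mul_left 2, fun h => IsCoprime.dvd_of_dvd_mul_left ?_ h⟩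
    exact Nat.isCoprime_iff_coprime.mpr (hc i).coprime_two_right
  rw [h2, ← ZMod.intCast_zmod_eq_zero_iff_dvd]
  simp only [sgnHom_evenTranslation, trnAt_evenTranslation, Units.val_one, Int.cast_one, one_mul,
    add_eq_left, toAdd_ofAdd]
  refine ⟨fun h => by simpa using h i, fun h j => ?_⟩
  rcases eq_or_ne j i with rfl | hj
  · simpa using h
  · simp [hj]

theorem stabilizer_modulus_injective {c c' : Fin 3 → ℕ} (hc : ∀ i, Odd (c i))
    (hc' : ∀ i, Odd (c' i)) {x : ResiduePoints c} {x' : ResiduePoints c'}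
    (h : MulAction.stabilizer hantzscheWendt x = MulAction.stabilizer hantzscheWendt x') :
    c = c' := by
  funext i
  have key (k : ℤ) : (c i : ℤ) ∣ k ↔ (c' i : ℤ) ∣ k := by
    rw [← axis_mem_stabilizer_iff hc x, h, axis_mem_stabilizer_iff hc']
  exact Nat.dvd_antisymm (Int.natCast_dvd_natCast.mp ((key _).mpr dvd_rfl))
    (Int.natCast_dvd_natCast.mp ((key _).mp dvd_rfl))

/-- A stabilizing element that reflects coordinate `i` with translation part t gives 2xᵢ = t, which
determines xᵢ for an odd modulus. -/
theorem stabilizer_injective (hc : ∀ i, Odd (c i)) {x x' : ResiduePoints c}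
    (h : MulAction.stabilizer hantzscheWendt x = MulAction.stabilizer hantzscheWendt x') :
    x = x' := by
  funext i
  obtain ⟨g, hg⟩ := exists_sgnHom_eq_neg_one i
  obtain ⟨g', hg', hs⟩ := exists_mem_stabilizer_sgnHom_eq hc x g
  have h1 := mem_stabilizer_residue.mp hg' i
  have h2 := mem_stabilizer_residue.mp (h ▸ hg') i
  rw [hs, hg] at h1 h2
  refine (isUnit_two_zmod (hc i)).mul_left_cancel ?_
  push_cast at h1 h2
  linear_combination h2 - h1

theorem evenTranslation_mem_of_axes {C : Subgroup hantzscheWendt} {a v : Fin 3 → ℤ}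
    (ha : ∀ i, evenTranslation (ofAdd (Pi.single i (a i))) ∈ C) (hv : ∀ i, a i ∣ v i) :
    evenTranslation (ofAdd v) ∈ C := by
  choose k hk using hv
  have h : ofAdd v = ∏ i, (ofAdd (Pi.single i (a i)) : Z3) ^ k i := by
    simp_rw [← ofAdd_zsmul]
    rw [← ofAdd_sum, ← Finset.univ_sum_single v]
    congr 1
    refine Finset.sum_congr rfl fun i _ => ?_
    rw [hk, ← Pi.single_smul, smul_eq_mul, mul_comm]
  rw [h, ← Subgroup.mem_comap]
  exact Subgroup.prod_mem _ fun i _ => Subgroup.zpow_mem _ (Subgroup.mem_comap.mpr (ha i)) _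

/-- If elements reflecting coordinates `j + 1` and `j + 2` both also reflect coordinate `j`, their
sign patterns are (−, −, +) and (−, +, −), with product (+, −, −). -/
theorem FullHolonomy.exists_rotation {Δ : Subgroup hantzscheWendt} (hΔ : FullHolonomy Δ)
    (j : Fin 3) : ∃ g ∈ Δ, sgnHom j g = 1 ∧ sgnHom (j + 1) g = -1 := by
  obtain ⟨a, ha, ha1⟩ := hΔ.exists_eq_neg_one (j + 1)
  obtain ⟨b, hb, hb2⟩ := hΔ.exists_eq_neg_one (j + 2)
  rcases Int.units_eq_one_or (sgnHom j a) with h | h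
  · exact ⟨a, ha, h, ha1⟩
  rcases Int.units_eq_one_or (sgnHom j b) with h' | h'
  · exact ⟨b, hb, h', by rw [← sgnHom_add_two_of h', hb2]⟩
  · have hb1 : sgnHom (j + 1) b = 1 := by simpa [h', hb2] using sgnHom_mul_mul j b
    exact ⟨a * b, Δ.mul_mem ha hb, by simp [h, h'], by simp [ha1, hb1]⟩

theorem FullHolonomy.exists_sgnHom_eq {Δ : Subgroup hantzscheWendt} (hΔ : FullHolonomy Δ)
    (g : hantzscheWendt) : ∃ h ∈ Δ, ∀ i, sgnHom i h = sgnHom i g := by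
  by_cases hg : g ∈ translations
  · exact ⟨1, Δ.one_mem, fun i => by rw [map_one, mem_translations.mp hg]⟩
  · have : ∃ j, sgnHom j g = 1 := by
      by_contra! hne
      have hneg := fun j => (Int.units_eq_one_or (sgnHom j g)).resolve_left (hne j)
      have := sgnHom_mul_mul 0 g
      rw [hneg, hneg, hneg] at this
      exact absurd this (by decide)
    obtain ⟨j, hj⟩ := this
    have hj1 : sgnHom (j + 1) g = -1 := by
      refine (Int.units_eq_one_or _).resolve_left fun h => hg (mem_translations.mpr ?_)
      exact forall_fin_three j hj h ((sgnHom_add_two_of hj).trans h)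
    obtain ⟨h, hh, h0, h1⟩ := hΔ.exists_rotation j
    refine ⟨h, hh, forall_fin_three j (h0.trans hj.symm) (h1.trans hj1.symm) ?_⟩
    rw [sgnHom_add_two_of h0, sgnHom_add_two_of hj, h1, hj1]

/-- Every subgroup with full holonomy is the stabilizer of a residue class of points. -/
theorem FullHolonomy.exists_eq_stabilizer {Δ : Subgroup hantzscheWendt} (hΔ : FullHolonomy Δ) :
    ∃ c : Fin 3 → ℕ, (∀ i, Odd (c i)) ∧
      ∃ x : ResiduePoints c, Δ = MulAction.stabilizer hantzscheWendt x := by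
  -- The modulus generates the translation parts along axis `i` of those elements of `Δ` that
  -- preserve this axis.
  let c : Fin 3 → ℕ := fun i => ((Δ.subgroupOf (sgnHom i).ker).map (trnHom i)).index
  have hc : ∀ i, Odd (c i) := fun i => by
    rw [odd_index_map_trnHom_iff]
    intro h
    obtain ⟨g, hg, h0, h1⟩ := hΔ.exists_rotation i
    have := mem_translations.mp (h ⟨g, h0⟩ hg) (i + 1)
    rw [h1] at this
    exact absurd this (by decide)
  have hdvd (i : Fin 3) (g : hantzscheWendt) (hg : g ∈ Δ) (h : sgnHom i g = 1) :
      (trnAt i g : ZMod (c i)) = 0 := by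
    rw [ZMod.intCast_zmod_eq_zero_iff_dvd]
    exact (exists_trnAt_eq_index (Δ.subgroupOf (sgnHom i).ker)).2 ⟨g, h⟩ hg
  have haxis (i : Fin 3) : evenTranslation (ofAdd (Pi.single i (c i : ℤ))) ∈ Δ := by
    obtain ⟨⟨g, hs⟩, hg, hgc⟩ := (exists_trnAt_eq_index (Δ.subgroupOf (sgnHom i).ker)).1
    replace hs : sgnHom i g = 1 := hs
    replace hg : g ∈ Δ := hg
    replace hgc : trnAt i g = c i := hgc
    have hs2 : sgnHom (i + 2) g = -1 := by
      rw [← negOnePow_trnAt, hgc, Int.negOnePow_eq_neg_one_iff]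
      exact_mod_cast hc i
    have hs1 : sgnHom (i + 1) g = -1 := by rw [← sgnHom_add_two_of hs, hs2]
    -- Squaring a half-turn screw kills the orthogonal parts and doubles the axial part `c i`.
    convert Δ.mul_mem hg hg using 1
    refine hantzscheWendt_ext (forall_fin_three i ?_ ?_ ?_)
    · rw [trnAt_evenTranslation, trnAt_mul, hs, hgc]
      simp [two_mul]
    · rw [trnAt_evenTranslation, trnAt_mul, hs1]
      simp
    · rw [trnAt_evenTranslation, trnAt_mul, hs2]
      simp
  choose r hr hrs using hΔ.exists_eq_neg_one
  -- The point is chosen so that each reflecting element `r i` fixes its coordinate `i` modulo `c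
  -- i`.
  obtain ⟨x, hx⟩ : ∃ x : ResiduePoints c, ∀ i, (trnAt i (r i) : ZMod (c i)) = 2 * x i := by
    choose x hx using fun i => (isUnit_two_zmod (hc i)).dvd (a := (trnAt i (r i) : ZMod (c i)))
    exact ⟨x, hx⟩
  have hle : Δ ≤ MulAction.stabilizer hantzscheWendt x := by
    intro g hg
    refine mem_stabilizer_residue.mpr fun i => ?_
    rcases Int.units_eq_one_or (sgnHom i g) with h | h
    · rw [h, hdvd i g hg h]
      simp
    -- The product of two elements reflecting coordinate `i` preserves it, so both have the same
    -- translation part modulo `c i`.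
    · have h1 := hdvd i (g * r i) (Δ.mul_mem hg (hr i)) (by rw [map_mul, h, hrs]; rfl)
      rw [trnAt_mul, h] at h1
      rw [h]
      push_cast at h1 ⊢
      linear_combination h1 + hx i
  refine ⟨c, hc, x, le_antisymm hle ?_⟩
  intro g hg
  -- Dividing by an element of `Δ` with the same signs leaves a stabilizing translation, which is a
  -- combination of the axial translations already in `Δ`.
  obtain ⟨h, hh, hs⟩ := hΔ.exists_sgnHom_eq g
  have hk : g * h⁻¹ ∈ translations := mem_translations.mpr fun i => by
    rw [map_mul, map_inv, hs, mul_inv_cancel]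
  obtain ⟨v, hv⟩ := exists_evenTranslation_eq hk
  have hstab : evenTranslation v ∈ MulAction.stabilizer hantzscheWendt x :=
    hv ▸ mul_mem hg (inv_mem (hle hh))
  have hmem : evenTranslation v ∈ Δ := by
    refine evenTranslation_mem_of_axes (v := v.toAdd) haxis fun i => ?_
    have := mem_stabilizer_residue.mp hstab i
    rw [sgnHom_evenTranslation, trnAt_evenTranslation, Units.val_one, Int.cast_one, one_mul,
      add_eq_left, ZMod.intCast_zmod_eq_zero_iff_dvd] at this
    refine IsCoprime.dvd_of_dvd_mul_left ?_ this
    exact Nat.isCoprime_iff_coprime.mpr (hc i).coprime_two_right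
  have := Δ.mul_mem hmem hh
  rwa [hv, inv_mul_cancel_right] at this

/-- Conjugation by the affine map `x ↦ c x + t`, in coordinates. -/
def affineConj {c : Fin 3 → ℕ} (hc : ∀ i, Odd (c i)) (t : Fin 3 → ℤ) :
    hantzscheWendt →* hantzscheWendt where
  toFun g := ⟨fun i => ⟨sgnHom i g, c i * trnAt i g + (1 - (sgnHom i g : ℤ)) * t i⟩, g.2.1,
    fun i => by
      change Int.negOnePow _ = sgnHom (i + 2) g
      -- The factor `1 - sgnHom i g` is 0 or 2, and an odd `c i` preserves parity, so the parity
      -- conditions of the group survive.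
      have h1 : Int.negOnePow ((1 - (sgnHom i g : ℤ)) * t i) = 1 := by
        rcases Int.units_eq_one_or (sgnHom i g) with h | h <;> simp [h]
      have h2 : Int.negOnePow (c i * trnAt i g) = Int.negOnePow (trnAt i g) := by
        have : Odd (c i : ℤ) := by exact_mod_cast hc i
        rw [Int.negOnePow_eq_iff, show (c i * trnAt i g - trnAt i g : ℤ) =
          (c i - 1) * trnAt i g by ring]
        exact (this.sub_odd odd_one).mul_right _
      rw [Int.negOnePow_add, h1, h2, mul_one, negOnePow_trnAt]⟩
  map_one' := hantzscheWendt_ext fun i => by simp [trnAt, sgnHom]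
  map_mul' g h := hantzscheWendt_ext fun i => by
    simp [trnAt, sgnHom]
    ring

theorem trnAt_affineConj (hc : ∀ i, Odd (c i)) (t : Fin 3 → ℤ) (g : hantzscheWendt) (i : Fin 3) :
    trnAt i (affineConj hc t g) = c i * trnAt i g + (1 - (sgnHom i g : ℤ)) * t i := rfl

theorem sgnHom_affineConj (hc : ∀ i, Odd (c i)) (t : Fin 3 → ℤ) (g : hantzscheWendt) (i : Fin 3) :
    sgnHom i (affineConj hc t g) = sgnHom i g := rfl

theorem affineConj_injective (hc : ∀ i, Odd (c i)) (t : Fin 3 → ℤ) :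
    Function.Injective (affineConj hc t) := by
  intro g h hgh
  refine hantzscheWendt_ext fun i => ?_
  have h1 := congrArg (trnAt i) hgh
  have h2 : sgnHom i g = sgnHom i h := by
    rw [← sgnHom_affineConj hc t g, hgh, sgnHom_affineConj]
  rw [trnAt_affineConj, trnAt_affineConj, h2, add_left_inj] at h1
  exact mul_left_cancel₀ (by exact_mod_cast (hc i).pos.ne') h1

/-- The residue class of an integral point. -/
def residuePoint (c : Fin 3 → ℕ) (t : Fin 3 → ℤ) : ResiduePoints c := fun i => (t i : ZMod (c i))

/-- Fixing the class of `t` means that each translation part is (1 − sign)·t modulo `c i`. The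
quotient by `c i` inherits the required parity because `c i` is odd. -/
theorem range_affineConj (hc : ∀ i, Odd (c i)) (t : Fin 3 → ℤ) :
    (affineConj hc t).range = MulAction.stabilizer hantzscheWendt
      (residuePoint c t) := by
  ext g
  rw [mem_stabilizer_residue]
  change _ ↔ ∀ i, ((sgnHom i g : ℤ) : ZMod (c i)) * t i + (trnAt i g : ZMod (c i)) = t i
  constructor
  · rintro ⟨h, rfl⟩ i
    rw [sgnHom_affineConj, trnAt_affineConj]
    push_cast
    simp
    ring
  · intro hg
    have hv (i : Fin 3) : ∃ v : ℤ, trnAt i g = c i * v + (1 - (sgnHom i g : ℤ)) * t i := by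
      have h1 : ((trnAt i g - (1 - (sgnHom i g : ℤ)) * t i : ℤ) : ZMod (c i)) = 0 := by
        push_cast
        linear_combination hg i
      rw [ZMod.intCast_zmod_eq_zero_iff_dvd] at h1
      obtain ⟨v, hv⟩ := h1
      exact ⟨v, by rw [← hv]; ring⟩
    choose v hv using hv
    have hpar (i : Fin 3) : (v i).negOnePow = sgnHom (i + 2) g := by
      have h1 : Int.negOnePow ((1 - (sgnHom i g : ℤ)) * t i) = 1 := by
        rcases Int.units_eq_one_or (sgnHom i g) with h | h <;> simp [h]
      have h2 : Int.negOnePow (c i * v i) = Int.negOnePow (v i) := by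
        have : Odd (c i : ℤ) := by exact_mod_cast hc i
        rw [Int.negOnePow_eq_iff, show (c i * v i - v i : ℤ) = (c i - 1) * v i by ring]
        exact (this.sub_odd odd_one).mul_right _
      rw [← negOnePow_trnAt, hv, Int.negOnePow_add, h1, h2, mul_one]
    exact ⟨⟨fun i => ⟨sgnHom i g, v i⟩, g.2.1, hpar⟩, hantzscheWendt_ext fun i => (hv i).symm⟩

theorem FullHolonomy.nonempty_mulEquiv {Δ : Subgroup hantzscheWendt} (hΔ : FullHolonomy Δ) :
    Nonempty (Δ ≃* hantzscheWendt) := by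
  obtain ⟨c, hc, x, rfl⟩ := hΔ.exists_eq_stabilizer
  choose t ht using fun i => ZMod.intCast_surjective (x i)
  obtain rfl : residuePoint c t = x := funext ht
  exact ⟨((MonoidHom.ofInjective (affineConj_injective hc t)).trans
    (MulEquiv.subgroupCongr (range_affineConj hc t))).symm⟩

/-- Factorizations into three odd factors. -/
abbrev OddFactorization (n : ℕ) : Type := {c : Fin 3 → ℕ // (∀ i, Odd (c i)) ∧ ∏ i, c i = n}

/-- The subgroups with full holonomy correspond to factorizations of the index into three odd
factors together with a residue class of points. -/
theorem nonempty_fullHolonomy_equiv (n : ℕ) :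
    Nonempty ((Σ c : OddFactorization n, ResiduePoints c.1) ≃
      {Δ : Subgroup hantzscheWendt // Δ.index = n ∧ FullHolonomy Δ}) := by
  refine ⟨Equiv.ofBijective (fun p => ⟨MulAction.stabilizer hantzscheWendt p.2,
    (index_stabilizer_residue p.1.2.1 p.2).trans p.1.2.2, fullHolonomy_stabilizer p.1.2.1 p.2⟩)
    ⟨?_, ?_⟩⟩
  · rintro ⟨⟨c, hc, hn⟩, x⟩ ⟨⟨c', hc', hn'⟩, x'⟩ h
    have h1 := congrArg Subtype.val h
    obtain rfl := stabilizer_modulus_injective hc hc' h1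
    obtain rfl := stabilizer_injective hc h1
    rfl
  · rintro ⟨Δ, hn, hΔ⟩
    obtain ⟨c, hc, x, rfl⟩ := hΔ.exists_eq_stabilizer
    exact ⟨⟨⟨c, hc, (index_stabilizer_residue hc x).symm.trans hn⟩, x⟩, rfl⟩

end FullHolonomy

/-! ### Holonomy determines the isomorphism type, and conversely -/

section IsomorphismTypes

/-- The translation part of a half-turn isometry along its axis. -/
def halfTurnAxisHom : halfTurn →* Multiplicative ℤ where
  toFun g := ofAdd (g.1 2).trn
  map_one' := rfl
  map_mul' g h := by
    rw [← ofAdd_add]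
    simp [g.2.2.1]

/-- The translations of the half-turn group orthogonal to its axis. -/
def halfTurnTranslation : Multiplicative (Fin 2 → ℤ) →* halfTurn where
  toFun w := ⟨translation (ofAdd ![w.toAdd 0, w.toAdd 1, 0]), by simp [mem_halfTurn]⟩
  map_one' := Subtype.ext (by funext i; fin_cases i <;> rfl)
  map_mul' v w := Subtype.ext (by funext i; fin_cases i <;> ext <;> simp)

theorem halfTurnTranslation_injective : Function.Injective halfTurnTranslation := by
  intro v w h
  have key (i : Fin 3) := congrArg (fun g : halfTurn => (g.1 i).trn) h
  have h0 : v.toAdd 0 = w.toAdd 0 := by simpa [halfTurnTranslation] using key 0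
  have h1 : v.toAdd 1 = w.toAdd 1 := by simpa [halfTurnTranslation] using key 1
  refine Multiplicative.toAdd.injective (funext fun i => ?_)
  fin_cases i
  exacts [h0, h1]

theorem range_halfTurnTranslation : halfTurnTranslation.range = halfTurnAxisHom.ker := by
  ext g
  constructor
  · rintro ⟨w, rfl⟩
    exact MonoidHom.mem_ker.mpr (by simp [halfTurnAxisHom, halfTurnTranslation])
  · intro hg
    have h2 : (g.1 2).trn = 0 := congrArg Multiplicative.toAdd (MonoidHom.mem_ker.mp hg)
    obtain ⟨g, e0, e2, e1⟩ := g
    have s0 : (g 0).sgn = 1 := by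
      rw [← e1, show (g 2).trn = 0 from h2, Int.negOnePow_zero]
    refine ⟨ofAdd ![(g 0).trn, (g 1).trn], Subtype.ext (funext fun i => ?_)⟩
    fin_cases i <;> ext <;> simp [halfTurnTranslation, e2, s0, ← e0]
    exact h2.symm

theorem nonempty_halfTurn_mulEquiv : Nonempty (halfTurn ≃* HalfTurnModel) := by
  have hx : screwR ∈ halfTurn := by simp [mem_halfTurn, screwR]
  refine nonempty_mulEquiv_semidirectProduct halfTurnAxisHom
    ((MonoidHom.ofInjective halfTurnTranslation_injective).trans
      (MulEquiv.subgroupCongr range_halfTurnTranslation)).symm (x := ⟨screwR, hx⟩)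
    one_ne_zero rfl (fun _ => one_dvd _) fun n hn => ?_
  rw [← range_halfTurnTranslation] at hn
  obtain ⟨w, rfl⟩ := hn
  refine Subtype.ext (funext fun i => ?_)
  fin_cases i <;> ext <;> simp [halfTurnTranslation, screwR]

theorem eq_one_of_eq_inv {z : Multiplicative ℤ} (h : z = z⁻¹) : z = 1 := by
  have : z.toAdd = -z.toAdd := congrArg Multiplicative.toAdd h
  exact Multiplicative.toAdd.injective (by rw [toAdd_one]; omega)

/-- The Hantzsche–Wendt group has no infinite cyclic quotient. -/
theorem hantzscheWendt_hom_int_eq_one (f : hantzscheWendt →* Multiplicative ℤ) : f = 1 := by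
  have haxis (i : Fin 3) : evenTranslation (ofAdd (Pi.single i 1)) ∈ f.ker := by
    obtain ⟨g, hg⟩ := exists_sgnHom_eq_neg_one i
    -- An axial translation is conjugate to its inverse, so its image in the torsion-free group ℤ is
    -- trivial. The square of any element is a translation, so the element dies as well.
    have h : g * evenTranslation (ofAdd (Pi.single i 1)) * g⁻¹ =
        (evenTranslation (ofAdd (Pi.single i 1)))⁻¹ := by
      refine hantzscheWendt_ext fun j => ?_
      rcases eq_or_ne j i with rfl | hj
      · simp [hg]
      · simp [hj, ← mul_assoc, ← Units.val_mul]
    have h' := congrArg f h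
    rw [map_mul, map_mul, map_inv, map_inv, mul_comm, inv_mul_cancel_left] at h'
    exact eq_one_of_eq_inv h'
  ext g
  have hg : g * g ∈ translations := mem_translations.mpr fun i => by
    rw [map_mul, Int.units_mul_self]
  obtain ⟨v, hv⟩ := exists_evenTranslation_eq hg
  have : g * g ∈ f.ker := hv ▸ evenTranslation_mem_of_axes (a := fun _ => 1) haxis
    fun _ => one_dvd _
  rw [MonoidHom.mem_ker, map_mul] at this
  rw [eq_one_of_eq_inv (eq_inv_of_mul_eq_one_left this)]
  rfl

theorem isEmpty_mulEquiv_hantzscheWendt_of_hom {H : Type*} [Group H] (f : H →* Multiplicative ℤ)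
    (hf : f ≠ 1) : IsEmpty (H ≃* hantzscheWendt) := by
  refine ⟨fun e => hf ?_⟩
  have h := hantzscheWendt_hom_int_eq_one (f.comp e.symm.toMonoidHom)
  ext x
  have := DFunLike.congr_fun h (e x)
  simpa using congrArg Multiplicative.toAdd this

theorem isEmpty_Z3_mulEquiv_hantzscheWendt : IsEmpty (Z3 ≃* hantzscheWendt) := by
  refine isEmpty_mulEquiv_hantzscheWendt_of_hom
    (AddMonoidHom.toMultiplicative (Pi.evalAddMonoidHom (fun _ : Fin 3 => ℤ) 0)) fun h => ?_
  have := congrArg Multiplicative.toAdd (DFunLike.congr_fun h (ofAdd fun _ => 1))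
  exact one_ne_zero this

theorem isEmpty_halfTurnModel_mulEquiv_hantzscheWendt :
    IsEmpty (HalfTurnModel ≃* hantzscheWendt) := by
  refine isEmpty_mulEquiv_hantzscheWendt_of_hom SemidirectProduct.rightHom fun h => ?_
  have := congrArg Multiplicative.toAdd
    (DFunLike.congr_fun h (SemidirectProduct.inr (ofAdd (1 : ℤ))))
  exact one_ne_zero this

/-- Commutativity would make the inversion action trivial, forcing −1 = 1 in ℤ. -/
theorem isEmpty_halfTurnModel_mulEquiv_Z3 : IsEmpty (HalfTurnModel ≃* Z3) := by
  refine ⟨fun e => ?_⟩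
  have hcomm (x y : HalfTurnModel) : x * y = y * x :=
    e.injective (by rw [map_mul, map_mul, mul_comm])
  have h := SemidirectProduct.inl_aut
    (φ := inversionAction (Multiplicative (Fin 2 → ℤ))) (ofAdd 1) (ofAdd fun _ => 1)
  rw [hcomm (SemidirectProduct.inr _), mul_assoc, ← map_mul, mul_inv_cancel, MonoidHom.map_one,
    mul_one] at h
  have h1 := SemidirectProduct.inl_injective h
  have h2 : inversionAction (Multiplicative (Fin 2 → ℤ)) (ofAdd 1) (ofAdd fun _ => 1) =
      (ofAdd fun _ => 1)⁻¹ := rfl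
  rw [h2] at h1
  have h3 : -(1 : ℤ) = 1 := congrFun (congrArg Multiplicative.toAdd h1) 0
  omega

theorem nonempty_mulEquiv_Z3_of_le {Δ : Subgroup hantzscheWendt} (hΔ : Δ.index ≠ 0)
    (h : Δ ≤ translations) : Nonempty (Δ ≃* Z3) := by
  have e₁ := (Subgroup.subgroupOfEquivOfLe h).symm
  have e₂ := translationsEquiv.subgroupMap (Δ.subgroupOf translations)
  have hidx : ((Δ.subgroupOf translations).map translationsEquiv.toMonoidHom).index ≠ 0 := by
    have := Subgroup.index_map_equiv (Δ.subgroupOf translations) translationsEquiv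
    refine fun h0 => hΔ ?_
    rw [← Subgroup.relIndex_mul_index h, Subgroup.relIndex, ← this]
    exact mul_eq_zero_of_left h0 _
  obtain ⟨e₃⟩ := nonempty_mulEquiv_of_index_ne_zero _ hidx
  exact ⟨(e₁.trans e₂).trans e₃⟩

/-- The elements of a subgroup fix the direction of one axis and are not all translations. -/
def AxialHolonomy (i : Fin 3) (Δ : Subgroup hantzscheWendt) : Prop :=
  Δ ≤ (sgnHom i).ker ∧ ¬ Δ ≤ translations

theorem odd_index_map_subgroupOf_iff {i : Fin 3} {Δ : Subgroup hantzscheWendt}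
    (h : Δ ≤ (sgnHom i).ker) :
    Odd ((Δ.subgroupOf (sgnHom i).ker).map (trnHom i)).index ↔ ¬ Δ ≤ translations := by
  rw [odd_index_map_trnHom_iff, not_iff_not]
  exact ⟨fun H g hg => H ⟨g, h hg⟩ hg, fun H g hg => H hg⟩

theorem AxialHolonomy.nonempty_mulEquiv {i : Fin 3} {Δ : Subgroup hantzscheWendt}
    (h : AxialHolonomy i Δ) (hΔ : Δ.index ≠ 0) : Nonempty (Δ ≃* HalfTurnModel) := by
  obtain ⟨e⟩ := nonempty_mulEquiv_halfTurnModel (Δ.subgroupOf (sgnHom i).ker)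
    (by
      rw [← Subgroup.relIndex_mul_index h.1] at hΔ
      exact left_ne_zero_of_mul hΔ)
    ((odd_index_map_subgroupOf_iff h.1).mpr h.2)
  exact ⟨(Subgroup.subgroupOfEquivOfLe h.1).symm.trans e⟩

/-- Signs 1 on two axes force sign 1 on the third. Hence the counts for the three axes add without
overlap. -/
theorem AxialHolonomy.unique {i j : Fin 3} {Δ : Subgroup hantzscheWendt}
    (hi : AxialHolonomy i Δ) (hj : AxialHolonomy j Δ) : i = j := by
  by_contra hne
  refine hi.2 fun g hg => mem_translations.mpr ?_
  have h0 : sgnHom i g = 1 := hi.1 hg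
  have h0' : sgnHom j g = 1 := hj.1 hg
  have : j = i + 1 ∨ j = i + 2 := by omega
  rcases this with rfl | rfl
  · exact forall_fin_three i h0 h0' ((sgnHom_add_two_of h0).trans h0')
  · exact forall_fin_three i h0 ((sgnHom_add_two_of h0).symm.trans h0') h0'

theorem holonomy_trichotomy (Δ : Subgroup hantzscheWendt) :
    Δ ≤ translations ∨ (∃ i, AxialHolonomy i Δ) ∨ FullHolonomy Δ := by
  by_cases h : Δ ≤ translations
  · exact Or.inl h
  by_cases h' : ∃ i, Δ ≤ (sgnHom i).ker
  · exact Or.inr (Or.inl (h'.imp fun _ hi => ⟨hi, h⟩))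
  · exact Or.inr (Or.inr (not_exists.mp h'))

variable {Δ : Subgroup hantzscheWendt}

/-- The holonomy cases exhaust all subgroups and lead to pairwise nonisomorphic groups, so the type
decides the case. -/
theorem nonempty_mulEquiv_Z3_iff (hΔ : Δ.index ≠ 0) :
    Nonempty (Δ ≃* Z3) ↔ Δ ≤ translations := by
  refine ⟨fun ⟨e⟩ => ?_, nonempty_mulEquiv_Z3_of_le hΔ⟩
  rcases holonomy_trichotomy Δ with h | ⟨i, h⟩ | h
  · exact h
  · obtain ⟨e'⟩ := h.nonempty_mulEquiv hΔ
    exact (isEmpty_halfTurnModel_mulEquiv_Z3.false (e'.symm.trans e)).elim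
  · obtain ⟨e'⟩ := h.nonempty_mulEquiv
    exact (isEmpty_Z3_mulEquiv_hantzscheWendt.false (e.symm.trans e')).elim

theorem nonempty_mulEquiv_halfTurnModel_iff (hΔ : Δ.index ≠ 0) :
    Nonempty (Δ ≃* HalfTurnModel) ↔ ∃ i, AxialHolonomy i Δ := by
  refine ⟨fun ⟨e⟩ => ?_, fun ⟨i, h⟩ => h.nonempty_mulEquiv hΔ⟩
  rcases holonomy_trichotomy Δ with h | h | h
  · obtain ⟨e'⟩ := nonempty_mulEquiv_Z3_of_le hΔ h
    exact (isEmpty_halfTurnModel_mulEquiv_Z3.false (e.symm.trans e')).elim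
  · exact h
  · obtain ⟨e'⟩ := h.nonempty_mulEquiv
    exact (isEmpty_halfTurnModel_mulEquiv_hantzscheWendt.false (e.symm.trans e')).elim

theorem nonempty_mulEquiv_hantzscheWendt_iff (hΔ : Δ.index ≠ 0) :
    Nonempty (Δ ≃* hantzscheWendt) ↔ FullHolonomy Δ := by
  refine ⟨fun ⟨e⟩ => ?_, fun h => h.nonempty_mulEquiv⟩
  rcases holonomy_trichotomy Δ with h | ⟨i, h⟩ | h
  · obtain ⟨e'⟩ := nonempty_mulEquiv_Z3_of_le hΔ h
    exact (isEmpty_Z3_mulEquiv_hantzscheWendt.false (e'.symm.trans e)).elim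
  · obtain ⟨e'⟩ := h.nonempty_mulEquiv hΔ
    exact (isEmpty_halfTurnModel_mulEquiv_hantzscheWendt.false (e'.symm.trans e)).elim
  · exact h

end IsomorphismTypes

/-! ### Identities for ω and d₃ -/

section Arithmetic

theorem factorSum_div (f : ℕ → ℕ → ℕ) (n : ℕ) {d : ℕ} (hd : d ≠ 0) :
    factorSum f ((n : ℚ) / d) = if d ∣ n then factorSum f ((n / d : ℕ) : ℚ) else 0 := by
  have hd' : (d : ℚ) ≠ 0 := by exact_mod_cast hd
  split_ifs with h
  · rw [Nat.cast_div h hd']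
  · refine if_neg fun hden => h ?_
    have h1 : (n : ℚ) / d = (((n : ℚ) / d).num : ℚ) := (Rat.den_eq_one_iff _).mp hden |>.symm
    rw [div_eq_iff hd'] at h1
    have h2 : (n : ℤ) = ((n : ℚ) / d).num * d := by exact_mod_cast h1
    exact Int.natCast_dvd_natCast.mp ⟨_, h2.trans (mul_comm _ _)⟩

/-- Halving the even second factor matches these factorizations of `m` with all factorizations of `m
/ 2`. -/
theorem sum_divisorsAntidiagonal_not_odd (g : ℕ → ℕ) (m : ℕ) :
    ∑ x ∈ m.divisorsAntidiagonal with ¬ Odd x.2, g x.1 =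
      if 2 ∣ m then ∑ x ∈ (m / 2).divisorsAntidiagonal, g x.1 else 0 := by
  split_ifs with h
  · obtain ⟨k, rfl⟩ := h
    rw [Nat.mul_div_cancel_left k two_pos]
    refine Finset.sum_nbij' (fun x => (x.1, x.2 / 2)) (fun x => (x.1, 2 * x.2)) ?_ ?_ ?_ ?_ ?_
    · rintro ⟨a, b⟩ hab
      simp only [Finset.mem_filter, Nat.mem_divisorsAntidiagonal, Nat.not_odd_iff_even] at hab ⊢
      obtain ⟨⟨h1, h2⟩, c, rfl⟩ := hab
      refine ⟨?_, by omega⟩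
      rw [← two_mul, Nat.mul_div_cancel_left c two_pos]
      linarith [h1]
    · rintro ⟨a, b⟩ hab
      simp only [Finset.mem_filter, Nat.mem_divisorsAntidiagonal, Nat.not_odd_iff_even] at hab ⊢
      refine ⟨⟨by rw [← hab.1]; ring, by omega⟩, even_two_mul b⟩
    · rintro ⟨a, b⟩ hab
      simp only [Finset.mem_filter, Nat.not_odd_iff_even] at hab
      simp only [Nat.mul_div_cancel' hab.2.two_dvd]
    · rintro ⟨a, b⟩ -
      simp only [Nat.mul_div_cancel_left b two_pos]
    · exact fun _ _ => rfl
  · refine Finset.sum_eq_zero fun x hx => (h ?_).elim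
    rw [Finset.mem_filter, Nat.mem_divisorsAntidiagonal, Nat.not_odd_iff_even] at hx
    exact hx.1.1 ▸ hx.2.two_dvd.mul_left _

theorem sum_odd_eq_omega_sub (m : ℕ) :
    ((∑ x ∈ m.divisorsAntidiagonal with Odd x.2, x.1 * sigma1 x.1 : ℕ) : ℤ) =
      omega (m : ℚ) - omega ((m : ℚ) / 2) := by
  have h1 : omega (m : ℚ) = _ := factorSum_natCast _ m
  have h2 : omega ((m : ℚ) / 2) = _ := factorSum_div _ m two_ne_zero
  rw [h2, factorSum_natCast, ← sum_divisorsAntidiagonal_not_odd (fun a => a * sigma1 a), h1,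
    ← Finset.sum_filter_add_sum_filter_not m.divisorsAntidiagonal (fun x : ℕ × ℕ => Odd x.2)]
  push_cast
  ring

theorem sigma0_natCast (m : ℕ) : sigma0 (m : ℚ) = m.divisorsAntidiagonal.card := by
  rw [sigma0, factorSum_natCast, Finset.sum_const, smul_eq_mul, mul_one]

/-- Writing d₃ as a Dirichlet convolution makes its multiplicativity available. -/
theorem d3_natCast (m : ℕ) :
    d3 (m : ℚ) = (ArithmeticFunction.sigma 0 * ArithmeticFunction.zeta) m := by
  rw [d3, factorSum_natCast, ArithmeticFunction.mul_apply]
  refine Finset.sum_congr rfl fun x hx => ?_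
  rw [sigma0_natCast, ArithmeticFunction.zeta_apply_ne (Nat.ne_zero_of_mem_divisorsAntidiagonal hx).2,
    mul_one, ArithmeticFunction.sigma_zero_apply, ← Nat.map_div_right_divisors, Finset.card_map]

theorem d3_two_pow_mul (k : ℕ) {m : ℕ} (hm : Odd m) :
    d3 ((2 ^ k * m : ℕ) : ℚ) = (∑ j ∈ Finset.range (k + 1), (j + 1)) * d3 (m : ℚ) := by
  have hmul : (ArithmeticFunction.sigma 0 * ArithmeticFunction.zeta).IsMultiplicative :=
    ArithmeticFunction.isMultiplicative_sigma.mul ArithmeticFunction.isMultiplicative_zeta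
  rw [d3_natCast, d3_natCast, hmul.map_mul_of_coprime (hm.coprime_two_left.pow_left k)]
  congr 1
  rw [ArithmeticFunction.mul_zeta_apply, Nat.sum_divisors_prime_pow Nat.prime_two]
  exact Finset.sum_congr rfl fun j _ =>
    ArithmeticFunction.sigma_zero_apply_prime_pow Nat.prime_two

/-- The combination of values of `d₃` that counts factorizations into three odd factors. -/
def oddD3 (n : ℕ) : ℤ :=
  (d3 (n : ℚ) : ℤ) - 3 * (d3 ((n : ℚ) / 2) : ℤ) + 3 * (d3 ((n : ℚ) / 4) : ℤ) -
    (d3 ((n : ℚ) / 8) : ℤ)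

theorem d3_div (n : ℕ) {d : ℕ} (hd : d ≠ 0) :
    d3 ((n : ℚ) / d) = if d ∣ n then d3 ((n / d : ℕ) : ℚ) else 0 := factorSum_div _ n hd

theorem oddD3_of_odd {n : ℕ} (hn : Odd n) : oddD3 n = d3 (n : ℚ) := by
  have h (d : ℕ) (hd : d ≠ 0) (h2 : 2 ∣ d) : d3 ((n : ℚ) / d) = 0 := by
    rw [d3_div n hd, if_neg fun hdn => Nat.not_even_iff_odd.mpr hn
      (even_iff_two_dvd.mpr (h2.trans hdn))]
  have h2 := h 2 (by norm_num) (by norm_num)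
  have h4 := h 4 (by norm_num) (by norm_num)
  have h8 := h 8 (by norm_num) (by norm_num)
  push_cast at h2 h4 h8
  simp [oddD3, h2, h4, h8]

theorem oddD3_of_even {n : ℕ} (hn : n ≠ 0) (he : Even n) : oddD3 n = 0 := by
  obtain ⟨k, m, hm, rfl⟩ := Nat.exists_eq_two_pow_mul_odd hn
  have hdiv (j : ℕ) : d3 (((2 ^ k * m : ℕ) : ℚ) / (2 ^ j : ℕ)) =
      if j ≤ k then (∑ i ∈ Finset.range (k - j + 1), (i + 1)) * d3 (m : ℚ) else 0 := by
    rw [d3_div _ (by positivity)]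
    have hiff : 2 ^ j ∣ 2 ^ k * m ↔ j ≤ k := by
      rw [Nat.Coprime.dvd_mul_right (hm.coprime_two_left.pow_left j),
        Nat.pow_dvd_pow_iff_le_right (by norm_num)]
    rw [if_congr hiff rfl rfl]
    split_ifs with h
    · rw [← d3_two_pow_mul _ hm]
      congr 2
      rw [Nat.mul_div_right_comm (pow_dvd_pow 2 h), Nat.pow_div h two_pos]
    · rfl
  have h0 := hdiv 0
  have h1 := hdiv 1
  have h2 := hdiv 2
  have h3 := hdiv 3
  norm_num only [pow_zero, pow_one, Nat.cast_one, Nat.cast_ofNat, div_one] at h0 h1 h2 h3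
  unfold oddD3
  rw [h1, h2, h3, d3_two_pow_mul k hm]
  -- The values at powers of 2 are triangular numbers, whose third differences vanish. Exponents 1
  -- and 2 are separate because some of the quotients by 4 or 8 are then not integers.
  rcases k with _ | _ | _ | k
  · simp at he
    exact absurd he (Nat.not_even_iff_odd.mpr hm)
  · simp [Finset.sum_range_succ]
  · simp [Finset.sum_range_succ]
    ring
  · simp [Finset.sum_range_succ]
    ring

end Arithmetic

/-! ### Counting subgroups of each holonomy type -/

section Counting

/-- Subgroups of `G` contained in `H` correspond to subgroups of `H`. -/
def subgroupsLeEquiv {G : Type*} [Group G] (H : Subgroup G) (n : ℕ) (Q : Subgroup G → Prop)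
    (Q' : Subgroup H → Prop) (hQ : ∀ Δ ≤ H, Q' (Δ.subgroupOf H) ↔ Q Δ) :
    {Δ : Subgroup G // Δ.index = n ∧ Δ ≤ H ∧ Q Δ} ≃
      {K : Subgroup H // K.index * H.index = n ∧ Q' K} where
  toFun Δ := ⟨Δ.1.subgroupOf H, (Subgroup.relIndex_mul_index Δ.2.2.1).trans Δ.2.1,
    (hQ _ Δ.2.2.1).mpr Δ.2.2.2⟩
  invFun K := ⟨K.1.map H.subtype, by
    have hle := Subgroup.map_subtype_le K.1
    have hK : (K.1.map H.subtype).subgroupOf H = K.1 :=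
      Subgroup.comap_map_eq_self_of_injective H.subtype_injective K.1
    refine ⟨?_, hle, ?_⟩
    · rw [← Subgroup.relIndex_mul_index hle, Subgroup.relIndex, hK, K.2.1]
    · rw [← hQ _ hle, hK]
      exact K.2.2⟩
  left_inv Δ := Subtype.ext (Subgroup.map_subgroupOf_eq_of_le Δ.2.2.1)
  right_inv K := Subtype.ext (Subgroup.comap_map_eq_self_of_injective H.subtype_injective K.1)

theorem card_le_translations {n : ℕ} (hn : n ≠ 0) :
    Finite {Δ : Subgroup hantzscheWendt // Δ.index = n ∧ Δ ≤ translations} ∧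
    Nat.card {Δ : Subgroup hantzscheWendt // Δ.index = n ∧ Δ ≤ translations} =
      omega ((n : ℚ) / 4) := by
  have e := subgroupsLeEquiv translations n (fun _ => True) (fun _ => True) (fun _ _ => Iff.rfl)
  simp only [and_true, index_translations] at e
  have hω : omega ((n : ℚ) / 4) = if 4 ∣ n then omega ((n / 4 : ℕ) : ℚ) else 0 :=
    factorSum_div _ n four_ne_zero
  rw [hω, Nat.card_congr e]
  split_ifs with h
  · obtain ⟨m, rfl⟩ := h
    have hm : m ≠ 0 := right_ne_zero_of_mul hn
    have hiff (k : ℕ) : k * 4 = 4 * m ↔ k = m := by omega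
    simp only [hiff] at e ⊢
    rw [Nat.mul_div_cancel_left m four_pos, ← subgroups_int_pow_three.2 m hm]
    have := (subgroups_int_pow_three.1.congr translationsEquiv.symm) m hm
    exact ⟨Finite.of_equiv _ e.symm, numSubgroups_congr translationsEquiv m⟩
  · have : IsEmpty {K : Subgroup translations // K.index * 4 = n} :=
      ⟨fun K => h ⟨K.1.index, by rw [mul_comm]; exact K.2.symm⟩⟩
    exact ⟨Finite.of_equiv _ e.symm, Nat.card_of_isEmpty⟩

/-- Such a subgroup has index n/2 in the kernel of the sign, and its axial image has odd index;
dropping the even indices subtracts ω(n/4). -/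
theorem card_axialHolonomy (i : Fin 3) {n : ℕ} (hn : n ≠ 0) :
    Finite {Δ : Subgroup hantzscheWendt // Δ.index = n ∧ AxialHolonomy i Δ} ∧
    (Nat.card {Δ : Subgroup hantzscheWendt // Δ.index = n ∧ AxialHolonomy i Δ} : ℤ) =
      omega ((n : ℚ) / 2) - omega ((n : ℚ) / 4) := by
  have e := subgroupsLeEquiv (sgnHom i).ker n (fun Δ => ¬ Δ ≤ translations)
    (fun K => Odd (K.map (trnHom i)).index) (fun _ h => odd_index_map_subgroupOf_iff h)
  simp only [index_ker_sgnHom] at e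
  change {Δ : Subgroup hantzscheWendt // Δ.index = n ∧ AxialHolonomy i Δ} ≃ _ at e
  rw [Nat.card_congr e]
  by_cases h : 2 ∣ n
  · obtain ⟨m, rfl⟩ := h
    have hm : m ≠ 0 := right_ne_zero_of_mul hn
    have hiff (k : ℕ) : k * 2 = 2 * m ↔ k = m := by omega
    simp only [hiff] at e ⊢
    obtain ⟨h1, h2⟩ := card_subgroups_index_map (trnHom_surjective i) normal_of_le_ker_trnHom
      (subgroups_int_pow_two.1.congr (kerTrnHomEquiv i).symm) Odd hm
    refine ⟨Finite.of_equiv _ e.symm, ?_⟩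
    have hq2 : ((2 * m : ℕ) : ℚ) / 2 = m := by push_cast; ring
    have hq4 : ((2 * m : ℕ) : ℚ) / 4 = (m : ℚ) / 2 := by push_cast; ring
    rw [h2, hq2, hq4, ← sum_odd_eq_omega_sub]
    congr 1
    refine Finset.sum_congr rfl fun x hx => ?_
    rw [numSubgroups_congr (kerTrnHomEquiv i), subgroups_int_pow_two.2 _
      (Nat.ne_zero_of_mem_divisorsAntidiagonal (Finset.mem_filter.mp hx).1).1]
  · have : IsEmpty {K : Subgroup (sgnHom i).ker //
        K.index * 2 = n ∧ Odd (K.map (trnHom i)).index} :=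
      ⟨fun K => h ⟨K.1.index, by rw [mul_comm]; exact K.2.1.symm⟩⟩
    have h2 : omega ((n : ℚ) / 2) = _ := factorSum_div _ n two_ne_zero
    have h4 : omega ((n : ℚ) / 4) = _ := factorSum_div _ n four_ne_zero
    rw [if_neg h] at h2
    rw [if_neg fun h' => h ((by norm_num : 2 ∣ 4).trans h')] at h4
    rw [h2, h4, Nat.card_of_isEmpty]
    exact ⟨Finite.of_equiv _ e.symm, rfl⟩

theorem card_exists_axialHolonomy {n : ℕ} (hn : n ≠ 0) :
    Finite {Δ : Subgroup hantzscheWendt // Δ.index = n ∧ ∃ i, AxialHolonomy i Δ} ∧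
    (Nat.card {Δ : Subgroup hantzscheWendt // Δ.index = n ∧ ∃ i, AxialHolonomy i Δ} : ℤ) =
      3 * omega ((n : ℚ) / 2) - 3 * omega ((n : ℚ) / 4) := by
  let e : (Σ i, {Δ : Subgroup hantzscheWendt // Δ.index = n ∧ AxialHolonomy i Δ}) ≃
      {Δ : Subgroup hantzscheWendt // Δ.index = n ∧ ∃ i, AxialHolonomy i Δ} :=
    Equiv.ofBijective (fun x => ⟨x.2.1, x.2.2.1, x.1, x.2.2.2⟩) (by
      constructor
      · rintro ⟨i, Δ, h1, h2⟩ ⟨j, Δ', h1', h2'⟩ h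
        obtain rfl : Δ = Δ' := congrArg Subtype.val h
        obtain rfl := h2.unique h2'
        rfl
      · rintro ⟨Δ, h, i, hi⟩
        exact ⟨⟨i, Δ, h, hi⟩, rfl⟩)
  have := fun i => (card_axialHolonomy i hn).1
  refine ⟨Finite.of_equiv _ e, ?_⟩
  rw [← Nat.card_congr e, Nat.card_sigma]
  push_cast
  rw [Finset.sum_congr rfl fun i _ => (card_axialHolonomy i hn).2,
    Finset.sum_const, Finset.card_univ, Fintype.card_fin, nsmul_eq_mul]
  push_cast
  ring

theorem isEmpty_oddFactorization {n : ℕ} (hn : Even n) : IsEmpty (OddFactorization n) := by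
  refine ⟨fun c => Nat.not_odd_iff_even.mpr hn ?_⟩
  have h := c.2.2
  rw [Fin.prod_univ_three] at h
  exact h ▸ ((c.2.1 0).mul (c.2.1 1)).mul (c.2.1 2)

/-- Factorizations of an odd number into three factors. -/
def oddFactorizationEquiv {n : ℕ} (hn : Odd n) : OddFactorization n ≃
    n.divisorsAntidiagonal.sigma fun x => x.1.divisorsAntidiagonal where
  toFun c := ⟨⟨(c.1 0 * c.1 1, c.1 2), (c.1 0, c.1 1)⟩, by
    have h := c.2.2
    rw [Fin.prod_univ_three] at h
    simp [h, hn.pos.ne', (c.2.1 0).pos.ne', (c.2.1 1).pos.ne']⟩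
  invFun x := ⟨![x.1.2.1, x.1.2.2, x.1.1.2], by
    obtain ⟨⟨⟨a, b⟩, ⟨p, q⟩⟩, hx⟩ := x
    simp only [Finset.mem_sigma, Nat.mem_divisorsAntidiagonal] at hx
    obtain ⟨⟨h1, -⟩, h2, -⟩ := hx
    subst h2
    subst h1
    rw [Nat.odd_mul, Nat.odd_mul] at hn
    refine ⟨fun i => ?_, by simp [Fin.prod_univ_three]⟩
    fin_cases i
    exacts [hn.1.1, hn.1.2, hn.2]⟩
  left_inv c := Subtype.ext (by funext i; fin_cases i <;> rfl)
  right_inv x := by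
    obtain ⟨⟨⟨a, b⟩, ⟨p, q⟩⟩, hx⟩ := x
    simp only [Finset.mem_sigma, Nat.mem_divisorsAntidiagonal] at hx
    obtain ⟨-, h2, -⟩ := hx
    subst h2
    rfl

theorem card_oddFactorization {n : ℕ} (hn : n ≠ 0) : Finite (OddFactorization n) ∧
    (Nat.card (OddFactorization n) : ℤ) = oddD3 n := by
  rcases Nat.even_or_odd n with h | h
  · have := isEmpty_oddFactorization h
    refine ⟨inferInstance, ?_⟩
    rw [Nat.card_of_isEmpty, oddD3_of_even hn h]
    rfl
  · refine ⟨Finite.of_equiv _ (oddFactorizationEquiv h).symm, ?_⟩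
    rw [Nat.card_congr (oddFactorizationEquiv h), oddD3_of_odd h, Nat.card_eq_fintype_card,
      Fintype.card_coe, Finset.card_sigma, d3, factorSum_natCast]
    simp only [sigma0_natCast]

/-- Each odd factorization of `n` carries ∏ cᵢ = n residue points, hence the factor `n`. -/
theorem card_fullHolonomy {n : ℕ} (hn : n ≠ 0) :
    Finite {Δ : Subgroup hantzscheWendt // Δ.index = n ∧ FullHolonomy Δ} ∧
    (Nat.card {Δ : Subgroup hantzscheWendt // Δ.index = n ∧ FullHolonomy Δ} : ℤ) =
      n * oddD3 n := by
  obtain ⟨e⟩ := nonempty_fullHolonomy_equiv n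
  obtain ⟨hfin, hcard⟩ := card_oddFactorization hn
  have := Fintype.ofFinite (OddFactorization n)
  have hres (c : OddFactorization n) : Nat.card (ResiduePoints c.1) = n := by
    change Nat.card (∀ i, ZMod (c.1 i)) = n
    rw [Nat.card_pi, Finset.prod_congr rfl fun i _ => Nat.card_zmod (c.1 i)]
    exact c.2.2
  have (c : OddFactorization n) : Finite (ResiduePoints c.1) :=
    Nat.finite_of_card_ne_zero (by rwa [hres])
  refine ⟨Finite.of_equiv _ e, ?_⟩
  rw [← Nat.card_congr e, Nat.card_sigma, Finset.sum_congr rfl fun c _ => hres c,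
    Finset.sum_const, Finset.card_univ, smul_eq_mul, ← hcard, Nat.card_eq_fintype_card]
  push_cast
  ring

/-- The subgroups of given index and type only depend on the groups up to isomorphism. -/
def subgroupsOfTypeEquiv {G G' H H' : Type*} [Group G] [Group G'] [Group H] [Group H']
    (e : G ≃* G') (f : H ≃* H') (n : ℕ) :
    subgroupsOfType H G n ≃ subgroupsOfType H' G' n :=
  e.mapSubgroup.toEquiv.subtypeEquiv fun Δ => by
    have h1 : (e.mapSubgroup Δ).index = Δ.index := Subgroup.index_map_equiv Δ e
    have e' : Δ ≃* e.mapSubgroup Δ := e.subgroupMap Δ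
    change _ ∧ _ ↔ (e.mapSubgroup Δ).index = n ∧ Nonempty (e.mapSubgroup Δ ≃* H')
    rw [h1]
    exact and_congr_right fun _ => ⟨fun ⟨g⟩ => ⟨(e'.symm.trans g).trans f⟩,
      fun ⟨g⟩ => ⟨(e'.trans g).trans f.symm⟩⟩

theorem finite_ncard_subgroupsOfType {G H H' : Type*} [Group G] [Group H] [Group H']
    (e : G ≃* hantzscheWendt) (f : H ≃* H') {n : ℕ} (hn : n ≠ 0)
    {P : Subgroup hantzscheWendt → Prop}
    (hP : ∀ Δ : Subgroup hantzscheWendt, Δ.index ≠ 0 → (Nonempty (Δ ≃* H') ↔ P Δ)) {a : ℤ}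
    (ha : Finite {Δ : Subgroup hantzscheWendt // Δ.index = n ∧ P Δ} ∧
      (Nat.card {Δ : Subgroup hantzscheWendt // Δ.index = n ∧ P Δ} : ℤ) = a) :
    (subgroupsOfType H G n).Finite ∧ ((subgroupsOfType H G n).ncard : ℤ) = a := by
  have e₁ := subgroupsOfTypeEquiv e f n
  have h : subgroupsOfType H' hantzscheWendt n = {Δ | Δ.index = n ∧ P Δ} :=
    Set.ext fun Δ => and_congr_right fun h => hP Δ (by rwa [h])
  rw [h] at e₁
  obtain ⟨h1, h2⟩ := ha
  have : Finite {Δ : Subgroup hantzscheWendt | Δ.index = n ∧ P Δ} := h1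
  refine ⟨Set.finite_coe_iff.mp (Finite.of_equiv _ e₁.symm), ?_⟩
  rw [← Nat.card_coe_set_eq, Nat.card_congr e₁]
  exact h2

end Counting

end FlatThree

end

theorem theorem1 (p : FlatThree.G6) (q : FlatThree.G2) :
    (∀ Δ : Subgroup (FundamentalGroup FlatThree.G6 p), Δ.FiniteIndex →
      Nonempty (Δ ≃* FundamentalGroup FlatThree.G6 p) ∨
      Nonempty (Δ ≃* FundamentalGroup FlatThree.G2 q) ∨
      Nonempty (Δ ≃* FlatThree.Z3)) ∧
    ∀ n : ℕ, 0 < n →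
      ((FlatThree.subgroupsOfType FlatThree.Z3
            (FundamentalGroup FlatThree.G6 p) n).Finite ∧
        ((FlatThree.subgroupsOfType FlatThree.Z3
            (FundamentalGroup FlatThree.G6 p) n).ncard : ℤ) =
          FlatThree.omega ((n : ℚ) / 4)) ∧
      ((FlatThree.subgroupsOfType (FundamentalGroup FlatThree.G2 q)
            (FundamentalGroup FlatThree.G6 p) n).Finite ∧
        ((FlatThree.subgroupsOfType (FundamentalGroup FlatThree.G2 q)
            (FundamentalGroup FlatThree.G6 p) n).ncard : ℤ) =
          3 * (FlatThree.omega ((n : ℚ) / 2) : ℤ) - 3 * (FlatThree.omega ((n : ℚ) / 4) : ℤ)) ∧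
      ((FlatThree.subgroupsOfType (FundamentalGroup FlatThree.G6 p)
            (FundamentalGroup FlatThree.G6 p) n).Finite ∧
        ((FlatThree.subgroupsOfType (FundamentalGroup FlatThree.G6 p)
            (FundamentalGroup FlatThree.G6 p) n).ncard : ℤ) =
          (n : ℤ) * ((FlatThree.d3 (n : ℚ) : ℤ) - 3 * (FlatThree.d3 ((n : ℚ) / 2) : ℤ)
            + 3 * (FlatThree.d3 ((n : ℚ) / 4) : ℤ) - (FlatThree.d3 ((n : ℚ) / 8) : ℤ))) := by
  obtain ⟨e₆⟩ := FlatThree.nonempty_fundamentalGroup_G6_mulEquiv p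
  obtain ⟨e₂⟩ := FlatThree.nonempty_fundamentalGroup_G2_mulEquiv q
  obtain ⟨e₂'⟩ := FlatThree.nonempty_halfTurn_mulEquiv
  have f₂ := e₂.trans e₂'
  refine ⟨fun Δ hΔ => ?_, fun n hn => ⟨?_, ?_, ?_⟩⟩
  · have hidx : (Δ.map (e₆ : _ →* FlatThree.hantzscheWendt)).index ≠ 0 := by
      rw [Subgroup.index_map_equiv]
      exact hΔ.index_ne_zero
    have e := e₆.subgroupMap Δ
    rcases FlatThree.holonomy_trichotomy (Δ.map (e₆ : _ →* FlatThree.hantzscheWendt)) with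
      h | ⟨i, h⟩ | h
    · obtain ⟨g⟩ := FlatThree.nonempty_mulEquiv_Z3_of_le hidx h
      exact Or.inr (Or.inr ⟨e.trans g⟩)
    · obtain ⟨g⟩ := h.nonempty_mulEquiv hidx
      exact Or.inr (Or.inl ⟨(e.trans g).trans f₂.symm⟩)
    · obtain ⟨g⟩ := h.nonempty_mulEquiv
      exact Or.inl ⟨(e.trans g).trans e₆.symm⟩
  · exact FlatThree.finite_ncard_subgroupsOfType e₆ (MulEquiv.refl _) hn.ne'
      (fun _ => FlatThree.nonempty_mulEquiv_Z3_iff)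
      ((FlatThree.card_le_translations hn.ne').imp id (congrArg _))
  · exact FlatThree.finite_ncard_subgroupsOfType e₆ f₂ hn.ne'
      (fun _ => FlatThree.nonempty_mulEquiv_halfTurnModel_iff)
      (FlatThree.card_exists_axialHolonomy hn.ne')
  · exact FlatThree.finite_ncard_subgroupsOfType e₆ e₆ hn.ne'
      (fun _ => FlatThree.nonempty_mulEquiv_hantzscheWendt_iff)
      (FlatThree.card_fullHolonomy hn.ne')
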